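/- **Abstract second-order central limit theorem.** *Setting.* Let $E$ be a locally compact separable metric space with its Borel $\sigma$-algebra. Let $(P_t)_{t\ge 0}$ be a (conservative) Feller semigroup on $E$ and let $\nu$ be an invariant probability distribution of it. Let $A$ be the infinitesimal generator of $(P_t)$ or, more generally, any linear operator, defined on a linear space of functions $E\to\mathbb R$, that extends the infinitesimal generator. Let $(\gamma_n)_{n\ge1}$ be positive steps with $\gamma_n\to0$ and $\sum_n\gamma_n=\infty$; put $\gamma_0=0$ and $\overline\gamma=\sup_{n\ge 1}\gamma_n$. Let $(Q_s)_{s>0}$ be Markov kernels on $E$ and write $Q_sf(x)=\int f(y)\,Q_s(x,dy)$, $\widetilde A_sf=(Q_sf-f)/s$. On a probability space $(\Omega,\mathcal G,\mathbb P)$ let $(X_n)_{n\ge0}$ be an $E$-valued Markov chain (with respect to its natural filtration) whose transition from time $n$ to time $n+1$ is $Q_{\gamma_{n+1}}$. For a weight sequence $w=(w_n)_{n\ge1}$ put $H_{w,n}=\sum_{k=1}^nw_k$ and $\nu_n^w(f)=H_{w,n}^{-1}\sum_{k=1}^nw_kf(X_{k-1})$. Let $C>0$, let $\eta_{n+1}=C(\gamma_n+\gamma_{n+1})/2$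 for $n\ge0$, and let $H_n=H_{\eta,n}$. Let $\tilde\eta_2,\epsilon_{\mathfrak X},\epsilon_{\mathcal{GC}}:\mathbb R_+\to\mathbb R_+$ be non-decreasing; write $H_{\tilde\eta_2,n}$, $\nu_n^{\tilde\eta_2}$, $H_{\epsilon_{\mathfrak X},n}$, $\nu_n^{\epsilon_{\mathfrak X}}$ for the above objects with weights $\tilde\eta_2(\gamma_n)$ and $\epsilon_{\mathfrak X}(\gamma_n)$, and assume $H_{\tilde\eta_2,n}\to\infty$ and $H_{\epsilon_{\mathfrak X},n}\to\infty$. Let $\rho\in[1,2]$ and let $g:E\to\mathbb R_+$ be Borel. Let $F$ be a set of Borel functions $f:E\to\mathbb R$ for which $Af$ is defined, continuous and bounded, and let $\mathfrak M_2,\mathfrak V$ be operators (linearity is not needed) that map every $f\in F$ to a Borel $\nu$-integrable function. *Assumption $\mathcal E_2$ (second-order weak expansion).* For every $f\in F$: $A^2f=A(Af)$ is defined and Borel; $f$ is $Q_s(x,\cdot)$-integrable for all $x\in E$, $s\in(0,\overline\gamma]$; $\nu_n^{\tilde\eta_2}(\mathfrak M_2f)\to\nu(\mathfrak M_2f)$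 a.s.; and, with $$\mathcal R_2f(x,s)=s\widetilde A_sf(x)-sAf(x)-\tfrac{s^2}2A^2f(x),\qquad \mathcal R_1Af(x,s)=s\widetilde A_sAf(x)-sA^2f(x),$$ one has, for all $x\in E$ and $s\in(0,\overline\gamma]$, $$\Big|-\mathcal R_2f(x,s)+\tfrac s2\mathcal R_1Af(x,s)-\tilde\eta_2(s)\,\mathfrak M_2f(x)\Big|\le\tilde\eta_2(s)\,\Lambda_f(x,s),\qquad \Lambda_f(x,s)=\sum_{i=1}^lg_{f,i}(x)\,\tilde{\mathbb E}\big[\tilde\Lambda_{f,i}(x,s,\cdot)\big].$$ Here $\tilde{\mathbb E}$ is the expectation on an auxiliary probability space $(\tilde\Omega,\tilde{\mathcal G},\tilde{\mathbb P})$, $l\in\mathbb N$, the $g_{f,i}:E\to\mathbb R_+$ are Borel and locally bounded with $\sup_n\nu_n^{\tilde\eta_2}(g_{f,i})<\infty$ a.s., the $\tilde\Lambda_{f,i}:E\times\mathbb R_+\times\tilde\Omega\to\mathbb R_+$ are measurable, $\sup_{x\in E,\,s\in(0,\overline\gamma]}\tilde\Lambda_{f,i}(x,s,\cdot)$ is dominated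 $\tilde{\mathbb P}$-a.s. by a $\tilde{\mathbb P}$-integrable variable, and for each $i$ at least one of the following holds: (I) there is a measurable $\underline\gamma:\tilde\Omega\to(0,\overline\gamma]$ such that, $\tilde{\mathbb P}(d\tilde\omega)$-a.s., $\lim_{s\to0}\sup_{x\in K}\tilde\Lambda_{f,i}(x,s,\tilde\omega)=0$ for every compact $K\subset E$ and $\lim_{x\to\infty}\sup_{s\in(0,\underline\gamma(\tilde\omega)]}\tilde\Lambda_{f,i}(x,s,\tilde\omega)=0$; (II) $\tilde{\mathbb P}(d\tilde\omega)$-a.s., $\lim_{s\to0}\sup_{x\in E}\tilde\Lambda_{f,i}(x,s,\tilde\omega)g_{f,i}(x)=0$. *Assumption $\mathcal{GC}_{Q,2}$ (growth control).* For every $f\in F$: $\nu_n^{\epsilon_{\mathfrak X}}(\mathfrak Vf)\to\nu(\mathfrak Vf)$ a.s., and there are square integrable variables $(\chi_n)_{n\ge1}$ and a constant $C_f>0$ such that, for all $n\ge0$, a.s., $\mathbb E[\chi_{n+1}\mid X_n]=0$, $\mathbb E[\chi_{n+1}^2\mid X_n]=\epsilon_{\mathfrak X}(\gamma_{n+1})\,\mathfrak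 Vf(X_n)$, $$\mathbb E\Big[\big|-(f(X_{n+1})-Q_{\gamma_{n+1}}f(X_n))+\tfrac{\gamma_{n+1}}2\big(Af(X_{n+1})-Q_{\gamma_{n+1}}Af(X_n)\big)-\chi_{n+1}\big|^\rho\,\Big|\,X_n\Big]\le C_f\,\epsilon_{\mathcal{GC}}(\gamma_{n+1})\,g(X_n),$$ and such that the Lindeberg condition holds: for every $\delta>0$, $$\frac1{H_{\epsilon_{\mathfrak X},n}}\sum_{k=0}^{n-1}\mathbb E\big[\chi_{k+1}^2\mathbf 1_{\{|\chi_{k+1}|>\delta\sqrt{H_{\epsilon_{\mathfrak X},n}}\}}\,\big|\,X_k\big]\longrightarrow0\quad\text{in probability.}$$ *Assumption $\mathcal{SW}_{\mathcal{GC},\gamma}$ (step weights).* Almost surely $\sum_{n\ge1}\epsilon_{\mathcal{GC}}(\gamma_n)\,H_{\epsilon_{\mathfrak X},n}^{-\rho/2}\,g(X_{n-1})<\infty$. *Assumption (boundary term).* For every $f\in F$, $f(X_n)/\sqrt{H_{\epsilon_{\mathfrak X},n}}\to0$ in probability. (This is automatic if $f$ is bounded, in particular if $f$ belongs to the domain of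 the infinitesimal generator in $\mathcal C_0(E)$.) *Conclusion.* For every $f\in F$, $\nu(\mathfrak Vf)\ge0$ and: **A.** If $\sqrt{H_{\epsilon_{\mathfrak X},n}}/H_{\tilde\eta_2,n}\to+\infty$, then $\dfrac{H_n}{C\sqrt{H_{\epsilon_{\mathfrak X},n}}}\,\nu_n^\eta(Af)\to\mathcal N(0,\nu(\mathfrak Vf))$ in law. **B.** If $\sqrt{H_{\epsilon_{\mathfrak X},n}}/H_{\tilde\eta_2,n}\to\hat l\in(0,\infty)$, then $\dfrac{H_n}{C\sqrt{H_{\epsilon_{\mathfrak X},n}}}\,\nu_n^\eta(Af)\to\mathcal N(\hat l^{-1}\nu(\mathfrak M_2f),\nu(\mathfrak Vf))$ in law. **C.** If $\sqrt{H_{\epsilon_{\mathfrak X},n}}/H_{\tilde\eta_2,n}\to0$, then $\dfrac{H_n}{C\,H_{\tilde\eta_2,n}}\,\nu_n^\eta(Af)\to\nu(\mathfrak M_2f)$ in probability. Moreover, if $\mathfrak Vf=0$ and $f(X_n)/H_{\tilde\eta_2,n}\to0$ a.s. (automatic if $f$ is bounded), this convergence holds almost surely. -/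

import Mathlib

open MeasureTheory ProbabilityTheory Filter Topology
open scoped ENNReal NNReal BigOperators ZeroAtInfty

namespace FellerCLT

/-- A (conservative) Feller semigroup on `E`, given by its transition kernels. -/
structure FellerSemigroup (E : Type*) [TopologicalSpace E] [MeasurableSpace E] where
  /-- the transition kernel `P_t(x, dy)` -/
  P : ℝ≥0 → Kernel E E
  isMarkov : ∀ t, IsMarkovKernel (P t)
  zero : P 0 = Kernel.id
  add : ∀ s t, P (s + t) = P t ∘ₖ P s
  /-- `P_t` maps `C₀(E)` to itself -/
  map_zeroAtInfty : ∀ (t : ℝ≥0) (f : C₀(E, ℝ)), ∃ h : C₀(E, ℝ), ∀ x, h x = ∫ y, f y ∂(P t x)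
  /-- `‖P_t f - f‖_∞ → 0` as `t → 0` -/
  strongCont : ∀ f : C₀(E, ℝ),
    TendstoUniformly (fun (t : ℝ≥0) x => ∫ y, f y ∂(P t x)) f (𝓝[>] 0)

/-- `f` lies in the domain of the infinitesimal generator, whose value at `f` is `h`:
`(P_t f - f) / t → h` in sup norm as `t → 0`. -/
def FellerSemigroup.IsGeneratorAt {E : Type*} [TopologicalSpace E] [MeasurableSpace E]
    (T : FellerSemigroup E) (f h : C₀(E, ℝ)) : Prop :=
  TendstoUniformly (fun (t : ℝ≥0) x => ((∫ y, f y ∂(T.P t x)) - f x) / (t : ℝ)) h (𝓝[>] 0)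

/-- `A` is a linear operator on functions `E → ℝ` that extends the infinitesimal generator. The
smallest such `A` is the generator itself; the differential operator of a diffusion, acting on
functions that need not vanish at infinity, is another. -/
def ExtendsGenerator {E : Type*} [TopologicalSpace E] [MeasurableSpace E]
    (T : FellerSemigroup E) (A : (E → ℝ) →ₗ.[ℝ] (E → ℝ)) : Prop :=
  ∀ f h : C₀(E, ℝ), T.IsGeneratorAt f h → ∃ hf : (f : E → ℝ) ∈ A.domain, A ⟨f, hf⟩ = h

/-- `A f` (with value `0` outside of the domain, where it is never used). -/
noncomputable def opApply {E : Type*} (A : (E → ℝ) →ₗ.[ℝ] (E → ℝ)) (f : E → ℝ) : E → ℝ :=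
  open scoped Classical in if hf : f ∈ A.domain then A ⟨f, hf⟩ else 0

/-- `ν` is an invariant distribution of the semigroup. -/
def FellerSemigroup.IsInvariant {E : Type*} [TopologicalSpace E] [MeasurableSpace E]
    (T : FellerSemigroup E) (ν : Measure E) : Prop :=
  ∀ t, Kernel.Invariant (T.P t) ν

/-- `H_{w,n} = w_1 + ⋯ + w_n`. -/
noncomputable def cumWeight (w : ℕ → ℝ) (n : ℕ) : ℝ := ∑ k ∈ Finset.Icc 1 n, w k

/-- `w_n ≥ 0` for `n ≥ 1` and `H_{w,n} → ∞`. -/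
structure IsWeight (w : ℕ → ℝ) : Prop where
  nonneg : ∀ n, 1 ≤ n → 0 ≤ w n
  tendsto_cumWeight : Tendsto (cumWeight w) atTop atTop

/-- A step sequence `(γ_n)_{n ≥ 1}`, with the convention `γ_0 = 0`. -/
structure IsStepSequence (γ : ℕ → ℝ) : Prop where
  zero : γ 0 = 0
  pos : ∀ n, 1 ≤ n → 0 < γ n
  tendsto_zero : Tendsto γ atTop (𝓝 0)
  tendsto_cumWeight : Tendsto (cumWeight γ) atTop atTop

/-- `γ̄ = sup_{n ≥ 1} γ_n`. -/
noncomputable def stepSup (γ : ℕ → ℝ) : ℝ := ⨆ n : ℕ, γ (n + 1)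

/-- An increasing function from `ℝ_+` to `ℝ_+`. -/
structure IsRate (φ : ℝ → ℝ) : Prop where
  nonneg : ∀ s, 0 ≤ s → 0 ≤ φ s
  mono : MonotoneOn φ (Set.Ici 0)

/-- `ν_n^w(f)`, the integral of `f` against the weighted empirical measure
`ν_n^w = H_{w,n}⁻¹ ∑_{k=1}^n w_k δ_{x_{k-1}}` of the path `x_0, x_1, …`. -/
noncomputable def empMean {E : Type*} (w : ℕ → ℝ) (x : ℕ → E) (n : ℕ) (f : E → ℝ) : ℝ :=
  (cumWeight w n)⁻¹ * ∑ k ∈ Finset.Icc 1 n, w k * f (x (k - 1))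

/-- The weights `η_{n+1} = C (γ_n + γ_{n+1}) / 2`. -/
noncomputable def midWeight (C : ℝ) (γ : ℕ → ℝ) (n : ℕ) : ℝ := C * (γ (n - 1) + γ n) / 2

/-- `Q f (x) = ∫ f(y) Q(x, dy)`. -/
noncomputable def kernelAvg {E : Type*} [MeasurableSpace E] (Q : Kernel E E) (f : E → ℝ) (x : E) :
    ℝ := ∫ y, f y ∂(Q x)

/-- The pseudo-generator `Ã_s f = (Q_s f - f) / s`. -/
noncomputable def pseudoGen {E : Type*} [MeasurableSpace E] (Q : ℝ → Kernel E E) (s : ℝ)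
    (f : E → ℝ) (x : E) : ℝ := (kernelAvg (Q s) f x - f x) / s

/-- `R_1 f (x, s) = s Ã_s f(x) - s A f(x)`. -/
noncomputable def rem1 {E : Type*} [MeasurableSpace E] (Q : ℝ → Kernel E E)
    (A : (E → ℝ) →ₗ.[ℝ] (E → ℝ)) (f : E → ℝ) (x : E) (s : ℝ) : ℝ :=
  s * pseudoGen Q s f x - s * opApply A f x

/-- `R_2 f (x, s) = s Ã_s f(x) - s A f(x) - (s² / 2) A² f(x)`. -/
noncomputable def rem2 {E : Type*} [MeasurableSpace E] (Q : ℝ → Kernel E E)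
    (A : (E → ℝ) →ₗ.[ℝ] (E → ℝ)) (f : E → ℝ) (x : E) (s : ℝ) : ℝ :=
  s * pseudoGen Q s f x - s * opApply A f x - s ^ 2 / 2 * opApply A (opApply A f) x

/-- The `σ`-algebra generated by `X_0, …, X_n`. -/
@[reducible] def pastSigma {Ω E : Type*} [MeasurableSpace E] (X : ℕ → Ω → E) (n : ℕ) : MeasurableSpace Ω :=
  ⨆ k : Fin (n + 1), MeasurableSpace.comap (X k) inferInstance

/-- The `σ`-algebra generated by `X_n`. -/
@[reducible] def presentSigma {Ω E : Type*} [MeasurableSpace E] (X : ℕ → Ω → E) (n : ℕ) : MeasurableSpace Ω :=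
  MeasurableSpace.comap (X n) inferInstance

/-- `(X_n)` (standing for `X̄_{Γ_n}`) is a Markov chain with transition `Q_{γ_{n+1}}` from time `n`
to time `n + 1`. -/
structure IsSchemeChain {Ω E : Type*} [MeasurableSpace Ω] [MeasurableSpace E] (μ : Measure Ω)
    (Q : ℝ → Kernel E E) (γ : ℕ → ℝ) (X : ℕ → Ω → E) : Prop where
  measurable : ∀ n, Measurable (X n)
  markov : ∀ (n : ℕ) (B : Set E), MeasurableSet B →
    μ[(X (n + 1) ⁻¹' B).indicator (fun _ => (1 : ℝ)) | pastSigma X n]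
      =ᵐ[μ] fun ω => (Q (γ (n + 1)) (X n ω)).real B

/-- Local boundedness. -/
def IsLocallyBounded {E : Type*} [TopologicalSpace E] (g : E → ℝ) : Prop :=
  ∀ x, ∃ U ∈ 𝓝 x, ∃ M : ℝ, ∀ y ∈ U, |g y| ≤ M

/-- First smallness property of one component `L(x, s, ω̃)` of the error density: for a.e. `ω̃`,
`sup_{x ∈ K} L → 0` as `s → 0` for every compact `K`, and `sup_{0 < s ≤ γ_low(ω̃)} L → 0` as
`x → ∞`, for some measurable `γ_low` with values in `(0, γ̄]`. -/
def SmallI {E Ω' : Type*} [TopologicalSpace E] [MeasurableSpace Ω'] (μ' : Measure Ω') (gbar : ℝ)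
    (L : E → ℝ → Ω' → ℝ) : Prop :=
  ∃ γlow : Ω' → ℝ, Measurable γlow ∧ (∀ w, γlow w ∈ Set.Ioc 0 gbar) ∧
    ∀ᵐ w ∂μ',
      (∀ K : Set E, IsCompact K → TendstoUniformlyOn (fun s x => L x s w) 0 (𝓝[>] 0) K) ∧
      TendstoUniformlyOn (fun x s => L x s w) 0 (cocompact E) (Set.Ioc 0 (γlow w))

/-- Second smallness property: for a.e. `ω̃`, `sup_x L(x, s, ω̃) g(x) → 0` as `s → 0`. -/
def SmallII {E Ω' : Type*} [MeasurableSpace Ω'] (μ' : Measure Ω')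
    (g : E → ℝ) (L : E → ℝ → Ω' → ℝ) : Prop :=
  ∀ᵐ w ∂μ', TendstoUniformly (fun s x => L x s w * g x) 0 (𝓝[>] 0)

/-- The requirements on the representation `Λ(x, s) = ∑_i g_i(x) Ẽ[L_i(x, s, ·)]` of the error. -/
structure IsErrorRep {Ω E Ω' : Type*} [MeasurableSpace Ω] [TopologicalSpace E] [MeasurableSpace E]
    [MeasurableSpace Ω'] (μ : Measure Ω) (μ' : Measure Ω') (X : ℕ → Ω → E) (w : ℕ → ℝ)
    (gbar : ℝ) {l : ℕ} (g : Fin l → E → ℝ) (L : Fin l → E → ℝ → Ω' → ℝ) : Prop where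
  g_measurable : ∀ i, Measurable (g i)
  g_nonneg : ∀ i x, 0 ≤ g i x
  g_locallyBounded : ∀ i, IsLocallyBounded (g i)
  L_measurable : ∀ i, Measurable fun p : E × ℝ × Ω' => L i p.1 p.2.1 p.2.2
  L_nonneg : ∀ i x s v, 0 ≤ L i x s v
  /-- `Ẽ[sup_x sup_{0 < s ≤ γ̄} L_i(x, s, ·)] < ∞` -/
  L_dominated : ∀ i, ∃ Y : Ω' → ℝ, Integrable Y μ' ∧
    ∀ᵐ v ∂μ', ∀ x, ∀ s ∈ Set.Ioc 0 gbar, L i x s v ≤ Y v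
  /-- `sup_{n ≥ 1} ν_n^w(g_i) < ∞` a.s. -/
  g_bounded : ∀ i, ∀ᵐ ω ∂μ,
    BddAbove (Set.range fun n : ℕ => empMean w (fun k => X k ω) (n + 1) (g i))
  L_small : ∀ i, SmallI μ' gbar (L i) ∨ SmallII μ' (g i) (L i)

/-- The class of test functions: Borel functions `f` for which `A f` is defined, continuous and
bounded. -/
structure IsTestClass {E : Type*} [TopologicalSpace E] [MeasurableSpace E]
    (A : (E → ℝ) →ₗ.[ℝ] (E → ℝ)) (F : Set (E → ℝ)) : Prop where
  measurable : ∀ f ∈ F, Measurable f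
  mem_domain : ∀ f ∈ F, f ∈ A.domain
  continuous_A : ∀ f ∈ F, Continuous (opApply A f)
  bounded_A : ∀ f ∈ F, ∃ M : ℝ, ∀ x, |opApply A f x| ≤ M

/-- The second order weak expansion `𝓔_2(F, Ã, A, 𝔐, η̃)` of the pseudo-generator. -/
structure WeakExpansion2 {Ω E Ω' : Type*} [MeasurableSpace Ω] [TopologicalSpace E]
    [MeasurableSpace E] [MeasurableSpace Ω'] (μ : Measure Ω) (μ' : Measure Ω') (ν : Measure E)
    (Q : ℝ → Kernel E E) (γ : ℕ → ℝ) (X : ℕ → Ω → E) (A : (E → ℝ) →ₗ.[ℝ] (E → ℝ))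
    (F : Set (E → ℝ)) (𝔐 : (E → ℝ) → E → ℝ) (ηt : ℝ → ℝ) : Prop where
  weight : IsWeight fun n => ηt (γ n)
  /-- `R_2 f` and `R_1 A f` are well defined. -/
  A_mem_domain : ∀ f ∈ F, opApply A f ∈ A.domain
  measurable_A2 : ∀ f ∈ F, Measurable (opApply A (opApply A f))
  integrable_Q : ∀ f ∈ F, ∀ s ∈ Set.Ioc 0 (stepSup γ), ∀ x, Integrable f (Q s x)
  measurable_M : ∀ f ∈ F, Measurable (𝔐 f)
  integrable_M : ∀ f ∈ F, Integrable (𝔐 f) ν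
  /-- `ν_n^{η̃}(𝔐 f) → ν(𝔐 f)` a.s. -/
  tendsto_M : ∀ f ∈ F, ∀ᵐ ω ∂μ,
    Tendsto (fun n => empMean (fun n => ηt (γ n)) (fun k => X k ω) n (𝔐 f)) atTop
      (𝓝 (∫ x, 𝔐 f x ∂ν))
  expansion : ∀ f ∈ F, ∃ (l : ℕ) (g : Fin l → E → ℝ) (L : Fin l → E → ℝ → Ω' → ℝ),
    IsErrorRep μ μ' X (fun n => ηt (γ n)) (stepSup γ) g L ∧
    ∀ x, ∀ s ∈ Set.Ioc 0 (stepSup γ),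
      |-rem2 Q A f x s + s / 2 * rem1 Q A (opApply A f) x s - ηt s * 𝔐 f x|
        ≤ ηt s * ∑ i, g i x * ∫ v, L i x s v ∂μ'

/-- The increment `-(f(X_{n+1}) - Q f(X_n)) + (γ_{n+1} / 2) (A f(X_{n+1}) - Q A f(X_n))`, where
`Q = Q_{γ_{n+1}}`. -/
noncomputable def martIncr {Ω E : Type*} [MeasurableSpace E] (Q : ℝ → Kernel E E) (γ : ℕ → ℝ)
    (X : ℕ → Ω → E) (A : (E → ℝ) →ₗ.[ℝ] (E → ℝ)) (f : E → ℝ) (n : ℕ) (ω : Ω) : ℝ :=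
  -(f (X (n + 1) ω) - kernelAvg (Q (γ (n + 1))) f (X n ω)) +
    γ (n + 1) / 2 *
      (opApply A f (X (n + 1) ω) - kernelAvg (Q (γ (n + 1))) (opApply A f) (X n ω))

/-- The requirements on the square integrable variables `(χ_n)_{n ≥ 1}` that approximate the
increments of `f`. The conditional expectation of the nonnegative variable in `approx` is the
`[0, ∞]`-valued one, so no integrability is presupposed there. -/
structure IsIncrApprox {Ω E : Type*} [MeasurableSpace Ω] [MeasurableSpace E]
    (μ : Measure Ω) (Q : ℝ → Kernel E E) (γ : ℕ → ℝ) (X : ℕ → Ω → E)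
    (A : (E → ℝ) →ₗ.[ℝ] (E → ℝ)) (f : E → ℝ) (g : E → ℝ) (ρ : ℝ) (εX εGC : ℝ → ℝ)
    (Vf : E → ℝ) (χ : ℕ → Ω → ℝ) : Prop where
  memLp : ∀ n, MemLp (χ (n + 1)) 2 μ
  centered : ∀ n, μ[χ (n + 1) | presentSigma X n] =ᵐ[μ] 0
  approx : ∃ C : ℝ, 0 < C ∧ ∀ n,
    μ⁻[fun ω => ENNReal.ofReal (|martIncr Q γ X A f n ω - χ (n + 1) ω| ^ ρ) | presentSigma X n]
      ≤ᵐ[μ] fun ω => ENNReal.ofReal (C * εGC (γ (n + 1)) * g (X n ω))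
  variance : ∀ n, μ[fun ω => χ (n + 1) ω ^ 2 | presentSigma X n]
    =ᵐ[μ] fun ω => εX (γ (n + 1)) * Vf (X n ω)
  lindeberg : ∀ δ : ℝ, 0 < δ → TendstoInMeasure μ
    (fun (n : ℕ) (ω : Ω) => (cumWeight (fun k => εX (γ k)) n)⁻¹ * ∑ k ∈ Finset.range n,
      (μ[{ω' | Real.sqrt (cumWeight (fun k => εX (γ k)) n) * δ < |χ (k + 1) ω'|}.indicator
        (fun ω' => χ (k + 1) ω' ^ 2) | presentSigma X k]) ω)
    atTop (fun _ => (0 : ℝ))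

/-- The growth control `𝓖𝓒_{Q,2}(F, g, ρ, ε_𝔛, ε_{𝓖𝓒}, 𝔙)`. -/
structure GrowthControl2 {Ω E : Type*} [MeasurableSpace Ω] [MeasurableSpace E]
    (μ : Measure Ω) (ν : Measure E) (Q : ℝ → Kernel E E) (γ : ℕ → ℝ) (X : ℕ → Ω → E)
    (A : (E → ℝ) →ₗ.[ℝ] (E → ℝ)) (F : Set (E → ℝ)) (g : E → ℝ) (ρ : ℝ) (εX εGC : ℝ → ℝ)
    (𝔙 : (E → ℝ) → E → ℝ) : Prop where
  weight : IsWeight fun n => εX (γ n)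
  measurable_V : ∀ f ∈ F, Measurable (𝔙 f)
  integrable_V : ∀ f ∈ F, Integrable (𝔙 f) ν
  /-- `ν_n^{ε_𝔛}(𝔙 f) → ν(𝔙 f)` a.s. -/
  tendsto_V : ∀ f ∈ F, ∀ᵐ ω ∂μ,
    Tendsto (fun n => empMean (fun n => εX (γ n)) (fun k => X k ω) n (𝔙 f)) atTop
      (𝓝 (∫ x, 𝔙 f x ∂ν))
  exists_approx : ∀ f ∈ F, ∃ χ : ℕ → Ω → ℝ, IsIncrApprox μ Q γ X A f g ρ εX εGC (𝔙 f) χ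

/-- The step-weight condition `𝓢𝓦_{𝓖𝓒,γ}(g, ρ, ε_𝔛, ε_{𝓖𝓒})`: a.s.,
`∑_{n ≥ 1} ε_{𝓖𝓒}(γ_n) H_{ε_𝔛,n}^{-ρ/2} g(X_{n-1}) < ∞`. -/
def StepWeightGC {Ω E : Type*} [MeasurableSpace Ω] (μ : Measure Ω) (γ : ℕ → ℝ)
    (X : ℕ → Ω → E) (g : E → ℝ) (ρ : ℝ) (εX εGC : ℝ → ℝ) : Prop :=
  ∀ᵐ ω ∂μ, Summable fun n : ℕ =>
    εGC (γ (n + 1)) / cumWeight (fun k => εX (γ k)) (n + 1) ^ (ρ / 2) * g (X n ω)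

end FellerCLT

open FellerCLT

/-! The weights `midWeight` are those of the trapezoidal rule. Over one step of size `s` from `x` to
`y`, the quantity `s / 2 * (A f x + A f y) - (f y - f x)` splits into a conditionally centered part
`martIncr` and a function `expErr` of the starting point. Summing over the steps
(`sum_midWeight_mul`) expresses `H_n ν_n^η(A f) / C` as a boundary term, a bounded last half-step, a
sum of `expErr` and a sum of `martIncr`. The three regimes compare the sizes of the last two sums.

The sum of `expErr`, divided by `H_η̃`, converges a.s. to `ν(𝔐 f)`. Indeed `expErr` is the
combination of remainders expanded in the hypothesis, because the `A²f` terms cancel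
(`rem_eq_expErr`), and the error of that expansion is averaged out by dominated convergence in the
auxiliary variable (`tendsto_weighted_error`).

The sum of `martIncr`, divided by `√H_εX`, converges in law to a centered Gaussian. The increments
need not be integrable: `f` is integrable under each `Q_s(x, ·)`, but not necessarily under the law
of the chain. They are therefore only known to have mean zero on events of the past on which they
are integrable, and the approximation by `χ` is only controlled in conditional `ρ`-th moment. The
argument works with conditional characteristic functions. A Taylor expansion with error of order `ρ`
in the perturbation (`norm_condExp_exp_sub_le`) shows each of them to be close to a Gaussian one.
The total error tends to zero in probability: the perturbations are negligible by the step-weight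
condition and Kronecker's lemma, the remaining terms by the Lindeberg condition. An exponential
martingale stopped at predictable levels (`norm_integral_exp_cutoff_sub_one_le`) turns this into
convergence of characteristic functions (`tendsto_integral_exp_sum`). The moment conditions are
stated given the present, while the exponential martingale needs the past; the Markov property makes
the two conditional characteristic functions of an increment equal.

Slutsky's theorem then gives A and B, and the convergence in probability of C. For the almost sure
statement, `𝔙 f = 0` forces `χ = 0` a.s., so the increments themselves have controlled moments.
Their normalized series converges a.s. (`ae_exists_tendsto_sum_of_summable`, by localization and
boundedness in `L¹`), and Kronecker's lemma concludes. -/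

namespace FellerCLT

/-! ### The Markov property for pairs of successive states -/

section Markov

lemma comap_le_pastSigma {Ω E : Type*} [MeasurableSpace E] (X : ℕ → Ω → E) {k n : ℕ}
    (h : k ≤ n) : MeasurableSpace.comap (X k) inferInstance ≤ pastSigma X n :=
  le_iSup (fun k : Fin (n + 1) => MeasurableSpace.comap (X k) inferInstance)
    ⟨k, Nat.lt_succ_of_le h⟩

lemma measurable_pastSigma {Ω E : Type*} [MeasurableSpace E] (X : ℕ → Ω → E) {k n : ℕ}
    (h : k ≤ n) : Measurable[pastSigma X n] (X k) :=
  Measurable.mono (comap_measurable (X k)) (comap_le_pastSigma X h) le_rfl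

variable {Ω E : Type*} [MeasurableSpace Ω] [MeasurableSpace E] {μ : Measure Ω} {Q : ℝ → Kernel E E} {γ : ℕ → ℝ} {X : ℕ → Ω → E}

lemma IsSchemeChain.pastSigma_le (hX : IsSchemeChain μ Q γ X) (n : ℕ) :
    pastSigma X n ≤ ‹MeasurableSpace Ω› :=
  iSup_le fun k => (hX.measurable k).comap_le

lemma IsSchemeChain.presentSigma_le (hX : IsSchemeChain μ Q γ X) (n : ℕ) :
    presentSigma X n ≤ ‹MeasurableSpace Ω› :=
  (hX.measurable n).comap_le

/-- The natural filtration of the chain. -/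
def IsSchemeChain.pastFiltration (hX : IsSchemeChain μ Q γ X) :
    Filtration ℕ ‹MeasurableSpace Ω› where
  seq := pastSigma X
  mono' := fun _ _ h => iSup_le fun k =>
    comap_le_pastSigma X ((Nat.lt_succ_iff.mp k.2).trans h)
  le' := hX.pastSigma_le

variable [IsProbabilityMeasure μ]

/-- The joint law of two successive states, on an event of the past. -/
lemma IsSchemeChain.map_restrict (hX : IsSchemeChain μ Q γ X) (n : ℕ)
    [IsMarkovKernel (Q (γ (n + 1)))] {S : Set Ω} (hS : MeasurableSet[pastSigma X n] S) :
    (μ.restrict S).map (fun ω => (X n ω, X (n + 1) ω))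
      = ((μ.restrict S).map (X n)) ⊗ₘ Q (γ (n + 1)) := by
  have hm := hX.pastSigma_le n
  have hXn := hX.measurable n
  have hXn1 := hX.measurable (n + 1)
  have : IsFiniteMeasure ((μ.restrict S).map (fun ω => (X n ω, X (n + 1) ω))) := inferInstance
  -- It suffices to compare rectangles `A × B`. There the event `X n ∈ A` is absorbed into the past
  -- event `S`, which reduces the claim to the defining property of the chain.
  refine Measure.ext_prod fun {A B} hA hB => ?_
  rw [Measure.map_apply (by fun_prop) (hA.prod hB), Measure.compProd_apply_prod hA hB,
    Measure.restrict_map hXn hA, lintegral_map ((Q _).measurable_coe hB) hXn,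
    Measure.restrict_restrict (hXn hA)]
  have hA' : MeasurableSet[pastSigma X n] (X n ⁻¹' A ∩ S) :=
    (measurable_pastSigma X le_rfl hA).inter hS
  have h1 : ∫ ω in X n ⁻¹' A ∩ S, (Q (γ (n + 1)) (X n ω)).real B ∂μ
      = μ.real (X (n + 1) ⁻¹' B ∩ (X n ⁻¹' A ∩ S)) := by
    rw [← integral_congr_ae (ae_restrict_of_ae (hX.markov n B hB)),
      setIntegral_condExp hm ((integrable_const _).indicator (hXn1 hB)) hA',
      integral_indicator (hXn1 hB)]
    simp [measureReal_restrict_apply (hXn1 hB)]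
  have h2 : ∫⁻ ω in X n ⁻¹' A ∩ S, Q (γ (n + 1)) (X n ω) B ∂μ
      = ENNReal.ofReal (∫ ω in X n ⁻¹' A ∩ S, (Q (γ (n + 1)) (X n ω)).real B ∂μ) := by
    rw [ofReal_integral_eq_lintegral_ofReal]
    · simp
    · refine Integrable.of_bound (C := 1) ?_ (ae_of_all _ fun ω => ?_)
      · exact (((Q _).measurable_coe hB).comp hXn).ennreal_toReal.aestronglyMeasurable
      · rw [Real.norm_of_nonneg measureReal_nonneg]; exact measureReal_le_one
    · exact ae_of_all _ fun ω => measureReal_nonneg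
  rw [h2, h1, Set.mk_preimage_prod, Measure.restrict_apply ((hXn hA).inter (hXn1 hB)), Measure.real,
    ENNReal.ofReal_toReal (measure_ne_top _ _)]
  congr 1
  ext ω; simp; tauto

lemma IsSchemeChain.setLIntegral_eq (hX : IsSchemeChain μ Q γ X) (n : ℕ)
    [IsMarkovKernel (Q (γ (n + 1)))] {S : Set Ω} (hS : MeasurableSet[pastSigma X n] S)
    {h : E × E → ℝ≥0∞} (hh : Measurable h) :
    ∫⁻ ω in S, h (X n ω, X (n + 1) ω) ∂μ
      = ∫⁻ ω in S, ∫⁻ y, h (X n ω, y) ∂(Q (γ (n + 1)) (X n ω)) ∂μ := by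
  have hXn := hX.measurable n
  have hXn1 := hX.measurable (n + 1)
  rw [← lintegral_map (μ := μ.restrict S) (f := h) hh (hXn.prodMk hXn1), hX.map_restrict n hS,
    Measure.lintegral_compProd hh,
    lintegral_map (Measurable.lintegral_kernel_prod_right' hh) hXn]

lemma IsSchemeChain.setIntegral_eq (hX : IsSchemeChain μ Q γ X) (n : ℕ)
    [IsMarkovKernel (Q (γ (n + 1)))] {S : Set Ω} (hS : MeasurableSet[pastSigma X n] S)
    {G : Type*} [NormedAddCommGroup G] [NormedSpace ℝ G] [SecondCountableTopology G]
    {h : E × E → G} (hh : StronglyMeasurable h)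
    (hi : IntegrableOn (fun ω => h (X n ω, X (n + 1) ω)) S μ) :
    ∫ ω in S, h (X n ω, X (n + 1) ω) ∂μ
      = ∫ ω in S, ∫ y, h (X n ω, y) ∂(Q (γ (n + 1)) (X n ω)) ∂μ := by
  have hXn := hX.measurable n
  have hXn1 := hX.measurable (n + 1)
  have hp : Measurable (fun ω => (X n ω, X (n + 1) ω)) := hXn.prodMk hXn1
  have hi' : Integrable h ((μ.restrict S).map (fun ω => (X n ω, X (n + 1) ω))) :=
    (integrable_map_measure hh.aestronglyMeasurable hp.aemeasurable).2 hi
  rw [← integral_map (μ := μ.restrict S) (f := h) hp.aemeasurable hh.aestronglyMeasurable,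
    hX.map_restrict n hS, Measure.integral_compProd (by rwa [← hX.map_restrict n hS]),
    integral_map hXn.aemeasurable]
  exact (hh.integral_kernel_prod_right').aestronglyMeasurable

end Markov

/-- Markov property: conditional expectations of functions of two successive states, given any
`σ`-algebra between the present and the past. -/
lemma IsSchemeChain.condExp_eq {Ω E : Type*} {m mΩ : MeasurableSpace Ω} [MeasurableSpace E]
    {μ : Measure Ω} [IsProbabilityMeasure μ] {Q : ℝ → Kernel E E} {γ : ℕ → ℝ} {X : ℕ → Ω → E}
    (hX : IsSchemeChain μ Q γ X) (n : ℕ) [IsMarkovKernel (Q (γ (n + 1)))] (hm1 : presentSigma X n ≤ m)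
    (hm2 : m ≤ pastSigma X n)
    {G : Type*} [NormedAddCommGroup G] [NormedSpace ℝ G] [SecondCountableTopology G]
    [CompleteSpace G] {h : E × E → G} (hh : StronglyMeasurable h)
    (hi : Integrable (fun ω => h (X n ω, X (n + 1) ω)) μ) :
    μ[fun ω => h (X n ω, X (n + 1) ω) | m]
      =ᵐ[μ] fun ω => ∫ y, h (X n ω, y) ∂(Q (γ (n + 1)) (X n ω)) := by
  have hXn := hX.measurable n
  have hp : Measurable (fun ω => (X n ω, X (n + 1) ω)) := hXn.prodMk (hX.measurable (n + 1))
  have hsm : StronglyMeasurable fun x => ∫ y, h (x, y) ∂(Q (γ (n + 1)) x) :=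
    hh.integral_kernel_prod_right'
  refine (ae_eq_condExp_of_forall_setIntegral_eq (hm2.trans (hX.pastSigma_le n)) hi
    (fun S _ _ => ?_) (fun S hS _ => ?_) ?_).symm
  -- Integrability of the inner integral is read off from the joint law, a composition product.
  · have hmap := hX.map_restrict n (S := Set.univ) MeasurableSet.univ
    rw [Measure.restrict_univ] at hmap
    have hi' : Integrable h (μ.map (X n) ⊗ₘ Q (γ (n + 1))) := by
      rw [← hmap]
      exact (integrable_map_measure hh.aestronglyMeasurable hp.aemeasurable).2 hi
    refine ((integrable_map_measure hsm.aestronglyMeasurable hXn.aemeasurable).1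
      ?_).integrableOn
    exact ((Measure.integrable_compProd_iff hh.aestronglyMeasurable).1 hi').2.mono'
      hsm.aestronglyMeasurable (ae_of_all _ fun x => norm_integral_le_integral_norm _)
  · exact (hX.setIntegral_eq n (hm2 _ hS) hh hi.integrableOn).symm
  · have : Measurable[m] (X n) := (comap_measurable (X n)).mono hm1 le_rfl
    exact (hsm.comp_measurable this).aestronglyMeasurable

/-! ### Convergence in probability to constants -/

section InMeasure

variable {Ω : Type*} [MeasurableSpace Ω] {μ : Measure Ω}

/-- A continuous function of two sequences that converge in probability to constants. -/
lemma tendstoInMeasure_map₂ {f g : ℕ → Ω → ℝ} {a b : ℝ} {F : ℝ → ℝ → ℝ}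
    (hf : TendstoInMeasure μ f atTop fun _ => a) (hg : TendstoInMeasure μ g atTop fun _ => b)
    (hF : ContinuousAt (Function.uncurry F) (a, b)) :
    TendstoInMeasure μ (fun n ω => F (f n ω) (g n ω)) atTop fun _ => F a b := by
  rw [tendstoInMeasure_iff_dist] at hf hg ⊢
  intro ε hε
  obtain ⟨δ, hδ, h⟩ := Metric.continuousAt_iff.1 hF ε hε
  refine tendsto_of_tendsto_of_tendsto_of_le_of_le tendsto_const_nhds
    (by simpa using (hf δ hδ).add (hg δ hδ)) (fun _ => zero_le) fun n => ?_
  refine (measure_mono fun ω hω => ?_).trans (measure_union_le _ _)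
  by_contra hc
  simp only [Set.mem_union, Set.mem_ofPred_eq, not_or, not_le] at hc hω
  have := h (x := (f n ω, g n ω)) (by rw [Prod.dist_eq]; exact max_lt hc.1 hc.2)
  exact absurd hω (not_le.2 this)

lemma tendstoInMeasure_add {f g : ℕ → Ω → ℝ} {a b : ℝ}
    (hf : TendstoInMeasure μ f atTop fun _ => a) (hg : TendstoInMeasure μ g atTop fun _ => b) :
    TendstoInMeasure μ (fun n ω => f n ω + g n ω) atTop fun _ => a + b :=
  tendstoInMeasure_map₂ (F := fun x y => x + y) hf hg (by fun_prop)

lemma tendstoInMeasure_mul {f g : ℕ → Ω → ℝ} {a b : ℝ}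
    (hf : TendstoInMeasure μ f atTop fun _ => a) (hg : TendstoInMeasure μ g atTop fun _ => b) :
    TendstoInMeasure μ (fun n ω => f n ω * g n ω) atTop fun _ => a * b :=
  tendstoInMeasure_map₂ (F := fun x y => x * y) hf hg (by fun_prop)

lemma tendstoInMeasure_of_tendsto {c : ℕ → ℝ} {a : ℝ} (h : Tendsto c atTop (𝓝 a)) :
    TendstoInMeasure μ (fun n (_ : Ω) => c n) atTop fun _ => a := by
  rw [tendstoInMeasure_iff_dist]
  intro ε hε
  refine tendsto_const_nhds.congr' ?_
  filter_upwards [Metric.tendsto_nhds.1 h ε hε] with n hn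
  simp [not_le.2 hn]

/-- Convergence in probability to zero by domination up to arbitrarily small constants. -/
lemma tendstoInMeasure_zero_of_forall_bound {f : ℕ → Ω → ℝ} (hf : ∀ n ω, 0 ≤ f n ω)
    (h : ∀ δ > 0, ∃ (W : ℕ → Ω → ℝ) (w : ℝ), w < δ ∧ (TendstoInMeasure μ W atTop fun _ => w) ∧
      ∀ᶠ n in atTop, ∀ᵐ ω ∂μ, f n ω ≤ W n ω) :
    TendstoInMeasure μ f atTop fun _ => 0 := by
  rw [tendstoInMeasure_iff_dist]
  intro δ hδ
  obtain ⟨W, w, hw, hW, hfW⟩ := h δ hδ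
  rw [tendstoInMeasure_iff_dist] at hW
  refine tendsto_of_tendsto_of_tendsto_of_le_of_le' tendsto_const_nhds
    (hW (δ - w) (by linarith)) (.of_forall fun _ => zero_le) ?_
  filter_upwards [hfW] with n hn
  refine measure_mono_ae ?_
  filter_upwards [hn] with ω hω h2
  change δ ≤ dist (f n ω) 0 at h2
  rw [Real.dist_eq, sub_zero, abs_of_nonneg (hf n ω)] at h2
  change δ - w ≤ |W n ω - w|
  exact (by linarith : δ - w ≤ W n ω - w).trans (le_abs_self _)

/-- Dominated convergence along a sequence of functions controlled by two sequences that converge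
in probability. -/
lemma tendsto_integral_of_tendstoInMeasure [IsFiniteMeasure μ] {V W : ℕ → Ω → ℝ} {v w : ℝ}
    (hV : TendstoInMeasure μ V atTop fun _ => v) (hW : TendstoInMeasure μ W atTop fun _ => w)
    {G : Type*} [NormedAddCommGroup G] [NormedSpace ℝ G]
    {F : ℕ → Ω → G} {K : ℝ} (hF : ∀ n, AEStronglyMeasurable (F n) μ) (hK : ∀ n ω, ‖F n ω‖ ≤ K)
    (h : ∀ ω (ns : ℕ → ℕ), Tendsto ns atTop atTop →
      Tendsto (fun i => V (ns i) ω) atTop (𝓝 v) → Tendsto (fun i => W (ns i) ω) atTop (𝓝 w) →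
      Tendsto (fun i => F (ns i) ω) atTop (𝓝 0)) :
    Tendsto (fun n => ∫ ω, F n ω ∂μ) atTop (𝓝 0) := by
  refine tendsto_of_subseq_tendsto fun ns hns => ?_
  obtain ⟨ms, hms, hV'⟩ := (hV.comp hns).exists_seq_tendsto_ae
  obtain ⟨ks, hks, hW'⟩ := ((hW.comp hns).comp hms.tendsto_atTop).exists_seq_tendsto_ae
  refine ⟨ms ∘ ks, ?_⟩
  have key : Tendsto (fun i => ∫ ω, F (ns (ms (ks i))) ω ∂μ) atTop (𝓝 (∫ _, (0 : G) ∂μ)) := by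
    refine tendsto_integral_of_dominated_convergence (fun _ => K) (fun _ => hF _)
      (integrable_const _) (fun _ => ae_of_all _ fun ω => hK _ ω) ?_
    filter_upwards [hV', hW'] with ω h1 h2
    exact h ω (fun i => ns (ms (ks i)))
      (hns.comp (hms.tendsto_atTop.comp hks.tendsto_atTop)) (h1.comp hks.tendsto_atTop) h2
  simpa using key

end InMeasure

/-! ### Characteristic functions of sums over martingale-type arrays -/

/-- The exponential martingale method for a single row of an array: `V` and `D` are the cumulated
variances and errors, and the row is stopped before they exceed `c` and `1`. -/
lemma norm_integral_exp_cutoff_sub_one_le {Ω : Type*} {mΩ : MeasurableSpace Ω} {μ : Measure Ω}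
    [IsProbabilityMeasure μ] {ℱ : Filtration ℕ mΩ} {Y s : ℕ → Ω → ℝ} {A : ℕ → Set Ω} {c : ℝ}
    (hY : ∀ k, Measurable[ℱ (k + 1)] (Y k)) (hs : ∀ k, Measurable[ℱ k] (s k))
    (hs0 : ∀ k ω, 0 ≤ s k ω) (hA : ∀ k, MeasurableSet[ℱ k] (A k))
    (hc : ∀ k ω, ∑ j ∈ Finset.range k, (A j).indicator (s j) ω ≤ c) (n : ℕ) :
    ‖(∫ ω, Complex.exp (Complex.I * (∑ k ∈ Finset.range n, (A k).indicator (Y k) ω : ℝ)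
        + ((∑ k ∈ Finset.range n, (A k).indicator (s k) ω : ℝ) : ℂ) / 2) ∂μ) - 1‖
      ≤ Real.exp (c / 2) * ∑ k ∈ Finset.range n, ∫ ω, (A k).indicator
          (fun ω => ‖(μ[fun ω => Complex.exp (Complex.I * Y k ω) | ℱ k]) ω
            - Complex.exp (-(s k ω : ℂ) / 2)‖) ω ∂μ := by
  set S' : ℕ → Ω → ℝ := fun n ω => ∑ k ∈ Finset.range n, (A k).indicator (Y k) ω with hS'
  set V' : ℕ → Ω → ℝ := fun n ω => ∑ k ∈ Finset.range n, (A k).indicator (s k) ω with hV'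
  have hS'm : ∀ n, Measurable[ℱ n] (S' n) := fun n =>
    Finset.measurable_sum _ fun k hk =>
      ((hY k).mono (ℱ.mono (Finset.mem_range.1 hk)) le_rfl).indicator
        (ℱ.mono (Finset.mem_range.1 hk).le _ (hA k))
  have hV'm : ∀ n, Measurable[ℱ n] (V' (n + 1)) := fun n =>
    Finset.measurable_sum _ fun k hk =>
      ((hs k).mono (ℱ.mono (Nat.lt_succ_iff.1 (Finset.mem_range.1 hk))) le_rfl).indicator
        (ℱ.mono (Nat.lt_succ_iff.1 (Finset.mem_range.1 hk)) _ (hA k))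
  have hV'm0 : ∀ n, Measurable (V' n) := fun n =>
    Finset.measurable_sum _ fun k _ => ((hs k).mono (ℱ.le k) le_rfl).indicator (ℱ.le k _ (hA k))
  have hS'm0 : ∀ n, Measurable (S' n) := fun n => (hS'm n).mono (ℱ.le n) le_rfl
  have hnorm : ∀ j k ω, ‖Complex.exp (Complex.I * (S' j ω : ℝ) + (V' k ω : ℂ) / 2)‖
      ≤ Real.exp (c / 2) := fun j k ω => by
    rw [Complex.norm_exp]
    simpa using div_le_div_of_nonneg_right (hc k ω) zero_le_two
  have hint : ∀ j k, Integrable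
      (fun ω => Complex.exp (Complex.I * (S' j ω : ℝ) + (V' k ω : ℂ) / 2)) μ := fun j k => by
    have h2 := hS'm0 j
    have h3 := hV'm0 k
    exact Integrable.of_bound (C := Real.exp (c / 2)) (Measurable.aestronglyMeasurable (by fun_prop))
      (ae_of_all _ (hnorm j k))
  have hstep : ∀ k, ‖(∫ ω, Complex.exp (Complex.I * (S' (k + 1) ω : ℝ) + (V' (k + 1) ω : ℂ) / 2) ∂μ)
      - ∫ ω, Complex.exp (Complex.I * (S' k ω : ℝ) + (V' k ω : ℂ) / 2) ∂μ‖
      ≤ Real.exp (c / 2) * ∫ ω, (A k).indicator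
          (fun ω => ‖(μ[fun ω => Complex.exp (Complex.I * Y k ω) | ℱ k]) ω
            - Complex.exp (-(s k ω : ℂ) / 2)‖) ω ∂μ := by
    intro k
    have hAk := ℱ.le k _ (hA k)
    have hYk : Measurable (Y k) := (hY k).mono (ℱ.le _) le_rfl
    have hsk : Measurable (s k) := (hs k).mono (ℱ.le _) le_rfl
    -- The exponent contains `V' (k + 1)` and not `V' k`: since `s k` is known at time `k`, `U` is
    -- still `ℱ k`-measurable. One step of the telescoping sum is then `U` times the difference of
    -- `exp (i Y k)` and `exp (-s k / 2)`, and conditioning replaces the former by its conditional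
    -- expectation.
    set U : Ω → ℂ := (A k).indicator
      fun ω => Complex.exp (Complex.I * (S' k ω : ℝ) + (V' (k + 1) ω : ℂ) / 2) with hU
    set φ := μ[fun ω => Complex.exp (Complex.I * Y k ω) | ℱ k] with hφ
    have hUsm : StronglyMeasurable[ℱ k] U := by
      have h1 : Measurable fun p : ℝ × ℝ => Complex.exp (Complex.I * p.1 + (p.2 : ℂ) / 2) := by
        fun_prop
      exact ((h1.comp ((hS'm k).prodMk (hV'm k))).stronglyMeasurable).indicator (hA k)
    have hUb : ∀ ω, ‖U ω‖ ≤ Real.exp (c / 2) := fun ω => by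
      by_cases hω : ω ∈ A k
      · simpa [hU, hω] using hnorm k (k + 1) ω
      · simpa [hU, hω] using (Real.exp_pos _).le
    have hUi : Integrable U μ := Integrable.of_bound (hUsm.mono (ℱ.le k)).aestronglyMeasurable _
      (ae_of_all _ hUb)
    have hei : Integrable (fun ω => Complex.exp (Complex.I * Y k ω)) μ :=
      Integrable.of_bound (C := 1) (Measurable.aestronglyMeasurable (by fun_prop))
        (ae_of_all _ fun ω => by rw [mul_comm, Complex.norm_exp_ofReal_mul_I])
    have hUei : Integrable (fun ω => U ω * Complex.exp (Complex.I * Y k ω)) μ :=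
      hei.bdd_mul hUi.aestronglyMeasurable (ae_of_all _ hUb)
    have hUφi : Integrable (fun ω => U ω * φ ω) μ :=
      integrable_condExp.bdd_mul hUi.aestronglyMeasurable (ae_of_all _ hUb)
    have hpull : ∫ ω, U ω * Complex.exp (Complex.I * Y k ω) ∂μ = ∫ ω, U ω * φ ω ∂μ := by
      rw [← integral_condExp (ℱ.le k)]
      refine integral_congr_ae ?_
      exact condExp_bilin_of_stronglyMeasurable_left (ContinuousLinearMap.mul ℝ ℂ) hUsm hUei hei
    have hdec : ∀ ω, Complex.exp (Complex.I * (S' (k + 1) ω : ℝ) + (V' (k + 1) ω : ℂ) / 2)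
        - Complex.exp (Complex.I * (S' k ω : ℝ) + (V' k ω : ℂ) / 2)
        = U ω * Complex.exp (Complex.I * Y k ω) - U ω * Complex.exp (-(s k ω : ℂ) / 2) := by
      intro ω
      by_cases hω : ω ∈ A k
      · have e1 : S' (k + 1) ω = S' k ω + Y k ω := by simp [hS', Finset.sum_range_succ, hω]
        have e2 : V' (k + 1) ω = V' k ω + s k ω := by simp [hV', Finset.sum_range_succ, hω]
        rw [hU, Set.indicator_of_mem hω, ← Complex.exp_add, ← Complex.exp_add, e1, e2]
        push_cast
        congr 2 <;> ring
      · have e1 : S' (k + 1) ω = S' k ω := by simp [hS', Finset.sum_range_succ, hω]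
        have e2 : V' (k + 1) ω = V' k ω := by simp [hV', Finset.sum_range_succ, hω]
        simp [hU, hω, e1, e2]
    have hexp : Integrable (fun ω => Complex.exp (-(s k ω : ℂ) / 2)) μ :=
      Integrable.of_bound (C := 1) (Measurable.aestronglyMeasurable (by fun_prop))
        (ae_of_all _ fun ω => by
          rw [Complex.norm_exp]
          have := hs0 k ω
          simp [neg_div]
          positivity)
    have hUsi : Integrable (fun ω => U ω * Complex.exp (-(s k ω : ℂ) / 2)) μ :=
      hexp.bdd_mul hUi.aestronglyMeasurable (ae_of_all _ hUb)
    rw [← integral_sub (hint _ _) (hint _ _), integral_congr_ae (ae_of_all _ hdec),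
      integral_sub hUei hUsi, hpull, ← integral_sub hUφi hUsi, ← integral_const_mul]
    refine norm_integral_le_of_norm_le ?_ (ae_of_all _ fun ω => ?_)
    · refine Integrable.const_mul ?_ _
      exact ((integrable_condExp.sub hexp).norm).indicator hAk
    · by_cases hω : ω ∈ A k
      · rw [Set.indicator_of_mem hω, ← mul_sub, norm_mul]
        exact mul_le_mul_of_nonneg_right (hUb ω) (norm_nonneg _)
      · simp [hU, hω]
  induction n with
  | zero => simp
  | succ n ih =>
    rw [Finset.sum_range_succ, mul_add]
    refine (norm_sub_le_norm_sub_add_norm_sub _ (∫ ω, Complex.exp (Complex.I * (S' n ω : ℝ)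
        + (V' n ω : ℂ) / 2) ∂μ) _).trans ?_
    rw [add_comm]
    exact add_le_add ih (hstep n)

/-- Convergence of characteristic functions for arrays whose conditional characteristic functions
are close to Gaussian ones. -/
theorem tendsto_integral_exp_sum {Ω : Type*} {mΩ : MeasurableSpace Ω} {μ : Measure Ω}
    [IsProbabilityMeasure μ] {ℱ : Filtration ℕ mΩ} {Y s : ℕ → ℕ → Ω → ℝ} {v : ℝ}
    (hY : ∀ n k, Measurable[ℱ (k + 1)] (Y n k)) (hs : ∀ n k, Measurable[ℱ k] (s n k))
    (hs0 : ∀ n k ω, 0 ≤ s n k ω)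
    (hv : TendstoInMeasure μ (fun n ω => ∑ k ∈ Finset.range n, s n k ω) atTop fun _ => v)
    (he : TendstoInMeasure μ (fun n ω => ∑ k ∈ Finset.range n,
      ‖(μ[fun ω => Complex.exp (Complex.I * Y n k ω) | ℱ k]) ω - Complex.exp (-(s n k ω : ℂ) / 2)‖)
      atTop fun _ => 0) :
    Tendsto (fun n => ∫ ω, Complex.exp (Complex.I * (∑ k ∈ Finset.range n, Y n k ω : ℝ)) ∂μ) atTop
      (𝓝 (Complex.exp (-(v : ℂ) / 2))) := by
  set e : ℕ → ℕ → Ω → ℝ := fun n k ω =>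
    ‖(μ[fun ω => Complex.exp (Complex.I * Y n k ω) | ℱ k]) ω - Complex.exp (-(s n k ω : ℂ) / 2)‖
    with he_def
  have hem : ∀ n k, Measurable[ℱ k] (e n k) := fun n k => by
    have h1 : Measurable fun x : ℝ => Complex.exp (-(x : ℂ) / 2) := by fun_prop
    exact (stronglyMeasurable_condExp.sub (h1.comp (hs n k)).stronglyMeasurable).norm.measurable
  have he0 : ∀ n k ω, 0 ≤ e n k ω := fun n k ω => norm_nonneg _
  set c : ℝ := |v| + 1 with hc_def
  have hc0 : 0 ≤ c := by positivity
  -- The sums run up to index `k` inclusive and are nevertheless `ℱ k`-measurable, because `s` and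
  -- `e` are. Stopping thus happens before a level is crossed, and there is no overshoot to
  -- estimate.
  set A : ℕ → ℕ → Set Ω := fun n k =>
    {ω | ∑ j ∈ Finset.range (k + 1), s n j ω ≤ c} ∩ {ω | ∑ j ∈ Finset.range (k + 1), e n j ω ≤ 1}
    with hA_def
  have hsum : ∀ (f : ℕ → Ω → ℝ), (∀ k, Measurable[ℱ k] (f k)) → ∀ k,
      Measurable[ℱ k] (fun ω => ∑ j ∈ Finset.range (k + 1), f j ω) := fun f hf k => by
    refine Finset.measurable_sum _ fun j hj => ?_
    exact (hf j).mono (ℱ.mono (Nat.lt_succ_iff.1 (Finset.mem_range.1 hj))) le_rfl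
  have hA : ∀ n k, MeasurableSet[ℱ k] (A n k) := fun n k =>
    (measurableSet_le (hsum _ (hs n) k) measurable_const).inter
      (measurableSet_le (hsum _ (hem n) k) measurable_const)
  have hAm : ∀ n k, MeasurableSet (A n k) := fun n k => ℱ.le k _ (hA n k)
  have hsm : ∀ n k, Measurable (s n k) := fun n k => (hs n k).mono (ℱ.le k) le_rfl
  have hYm : ∀ n k, Measurable (Y n k) := fun n k => (hY n k).mono (ℱ.le _) le_rfl
  have hem' : ∀ n k, Measurable (e n k) := fun n k => (hem n k).mono (ℱ.le k) le_rfl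
  have hcut : ∀ (f : ℕ → ℕ → Ω → ℝ) (a : ℝ), 0 ≤ a → (∀ n k ω, 0 ≤ f n k ω) →
      (∀ n k ω, ω ∈ A n k → ∑ j ∈ Finset.range (k + 1), f n j ω ≤ a) →
      ∀ n k ω, ∑ j ∈ Finset.range k, (A n j).indicator (f n j) ω ≤ a := by
    intro f a ha hf hfa n k ω
    induction k with
    | zero => simpa
    | succ k ih =>
      -- On `A n k` the uncut sum is already below the level and dominates the cut one; off it the
      -- last term disappears.
      by_cases hω : ω ∈ A n k
      · refine (Finset.sum_le_sum fun j _ => ?_).trans (hfa n k ω hω)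
        exact Set.indicator_apply_le' (fun _ => le_rfl) fun _ => hf n j ω
      · simpa [Finset.sum_range_succ, hω] using ih
  have hVc := hcut s c hc0 hs0 fun n k ω hω => hω.1
  have hE1 := hcut e 1 zero_le_one he0 fun n k ω hω => hω.2
  set S' : ℕ → Ω → ℝ := fun n ω => ∑ k ∈ Finset.range n, (A n k).indicator (Y n k) ω with hS'
  set V' : ℕ → Ω → ℝ := fun n ω => ∑ k ∈ Finset.range n, (A n k).indicator (s n k) ω with hV'
  set E' : ℕ → Ω → ℝ := fun n ω => ∑ k ∈ Finset.range n, (A n k).indicator (e n k) ω with hE'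
  have hS'm : ∀ n, Measurable (S' n) := fun n =>
    Finset.measurable_sum _ fun k _ => (hYm n k).indicator (hAm n k)
  have hV'm : ∀ n, Measurable (V' n) := fun n =>
    Finset.measurable_sum _ fun k _ => (hsm n k).indicator (hAm n k)
  have hE'm : ∀ n, Measurable (E' n) := fun n =>
    Finset.measurable_sum _ fun k _ => (hem' n k).indicator (hAm n k)
  have hSm : ∀ n, Measurable (fun ω => ∑ k ∈ Finset.range n, Y n k ω) := fun n =>
    Finset.measurable_sum _ fun k _ => hYm n k
  have hE'0 : ∀ n ω, 0 ≤ E' n ω := fun n ω =>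
    Finset.sum_nonneg fun k _ => Set.indicator_nonneg (fun _ _ => he0 n k _) _
  -- on the event of both limits being in force, nothing is stopped
  have hall : ∀ n ω, ∑ k ∈ Finset.range n, s n k ω ≤ c → ∑ k ∈ Finset.range n, e n k ω ≤ 1 →
      ∀ k ∈ Finset.range n, ω ∈ A n k := by
    intro n ω h1 h2 k hk
    have hsub : Finset.range (k + 1) ⊆ Finset.range n :=
      Finset.range_subset_range.2 (Finset.mem_range.1 hk)
    exact ⟨(Finset.sum_le_sum_of_subset_of_nonneg hsub fun j _ _ => hs0 n j ω).trans h1,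
      (Finset.sum_le_sum_of_subset_of_nonneg hsub fun j _ _ => he0 n j ω).trans h2⟩
  have hcut_eq : ∀ n ω, ∑ k ∈ Finset.range n, s n k ω ≤ c → ∑ k ∈ Finset.range n, e n k ω ≤ 1 →
      ∀ f : ℕ → Ω → ℝ, ∑ k ∈ Finset.range n, (A n k).indicator (f k) ω
        = ∑ k ∈ Finset.range n, f k ω := fun n ω h1 h2 f =>
    Finset.sum_congr rfl fun k hk => Set.indicator_of_mem (hall n ω h1 h2 k hk) _
  have hZnorm : ∀ n ω, ‖Complex.exp (Complex.I * (S' n ω : ℝ) + (V' n ω : ℂ) / 2)‖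
      ≤ Real.exp (c / 2) := fun n ω => by
    rw [Complex.norm_exp]
    simpa using div_le_div_of_nonneg_right (hVc n n ω) zero_le_two
  have hErr : Tendsto (fun n => ∫ ω, E' n ω ∂μ) atTop (𝓝 0) := by
    refine tendsto_integral_of_tendstoInMeasure hv he (K := 1)
      (fun n => (hE'm n).aestronglyMeasurable)
      (fun n ω => by rw [Real.norm_of_nonneg (hE'0 n ω)]; exact hE1 n n ω) ?_
    intro ω ns _ _ h2
    refine squeeze_zero (fun i => hE'0 _ _) (fun i => ?_) h2
    exact Finset.sum_le_sum fun j _ => Set.indicator_apply_le' (fun _ => le_rfl) fun _ => he0 _ j ω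
  -- Once nothing is cut, the integrand has modulus `|1 - exp (-v / 2) exp (V / 2)|`, where `V` is
  -- the cumulated variance, and `V` tends to `v`.
  have hDiff : Tendsto (fun n => ∫ ω, (Complex.exp (Complex.I * (∑ k ∈ Finset.range n, Y n k ω : ℝ))
      - Complex.exp (-(v : ℂ) / 2) * Complex.exp (Complex.I * (S' n ω : ℝ) + (V' n ω : ℂ) / 2)) ∂μ)
      atTop (𝓝 0) := by
    refine tendsto_integral_of_tendstoInMeasure hv he
      (K := 1 + ‖Complex.exp (-(v : ℂ) / 2)‖ * Real.exp (c / 2)) (fun n => ?_) (fun n ω => ?_) ?_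
    · have h1 := hSm n
      have h2 := hS'm n
      have h3 := hV'm n
      exact Measurable.aestronglyMeasurable (by fun_prop)
    · refine (norm_sub_le _ _).trans (add_le_add ?_ ?_)
      · rw [mul_comm, Complex.norm_exp_ofReal_mul_I]
      · rw [norm_mul]
        exact mul_le_mul_of_nonneg_left (hZnorm n ω) (norm_nonneg _)
    · intro ω ns _ h1 h2
      have hb : Tendsto (fun i => ‖(1 : ℂ) - Complex.exp (-(v : ℂ) / 2) *
          Complex.exp (((∑ k ∈ Finset.range (ns i), s (ns i) k ω : ℝ) : ℂ) / 2)‖) atTop (𝓝 0) := by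
        have : ContinuousAt (fun x : ℝ => ‖(1 : ℂ) - Complex.exp (-(v : ℂ) / 2) *
          Complex.exp ((x : ℂ) / 2)‖) v := by fun_prop
        have h3 := this.tendsto.comp h1
        have h4 : ‖(1 : ℂ) - Complex.exp (-(v : ℂ) / 2) * Complex.exp ((v : ℂ) / 2)‖ = 0 := by
          rw [← Complex.exp_add]; simp [neg_div]
        rwa [h4] at h3
      rw [tendsto_zero_iff_norm_tendsto_zero]
      refine hb.congr' ?_
      filter_upwards [h1.eventually_le_const (lt_of_le_of_lt (le_abs_self v) (lt_add_one _)),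
        h2.eventually_le_const zero_lt_one] with i hi1 hi2
      have e1 : S' (ns i) ω = ∑ k ∈ Finset.range (ns i), Y (ns i) k ω := hcut_eq _ ω hi1 hi2 _
      have e2 : V' (ns i) ω = ∑ k ∈ Finset.range (ns i), s (ns i) k ω := hcut_eq _ ω hi1 hi2 _
      rw [e1, e2, Complex.exp_add]
      rw [show ∀ a b d : ℂ, a - b * (a * d) = a * (1 - b * d) from fun a b d => by ring, norm_mul,
        mul_comm Complex.I, Complex.norm_exp_ofReal_mul_I, one_mul]
  have hZ : Tendsto (fun n => ∫ ω, Complex.exp (Complex.I * (S' n ω : ℝ) + (V' n ω : ℂ) / 2) ∂μ)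
      atTop (𝓝 1) := by
    rw [tendsto_iff_norm_sub_tendsto_zero]
    refine squeeze_zero (fun _ => norm_nonneg _)
      (fun n => norm_integral_exp_cutoff_sub_one_le (hY n) (hs n) (hs0 n) (hA n) (hVc n) n) ?_
    have := hErr.const_mul (Real.exp (c / 2))
    rw [mul_zero] at this
    refine this.congr fun n => ?_
    rw [← integral_finsetSum]
    intro k _
    refine Integrable.of_bound (C := 1) ((hem' n k).indicator (hAm n k)).aestronglyMeasurable
      (ae_of_all _ fun ω => ?_)
    rw [Real.norm_of_nonneg (Set.indicator_nonneg (fun _ _ => he0 n k _) _)]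
    refine le_trans ?_ (hE1 n (k + 1) ω)
    exact Finset.single_le_sum (f := fun k => (A n k).indicator (e n k) ω)
      (fun j _ => Set.indicator_nonneg (fun _ _ => he0 n j _) _) (Finset.self_mem_range_succ k)
  have hfin := hDiff.add (hZ.const_mul (Complex.exp (-(v : ℂ) / 2)))
  rw [mul_one, zero_add] at hfin
  refine hfin.congr fun n => ?_
  have h1 := hSm n
  have h2 := hS'm n
  have h3 := hV'm n
  rw [← integral_const_mul, ← integral_add]
  · refine integral_congr_ae (ae_of_all _ fun ω => ?_)
    simp
  · refine (Integrable.of_bound (C := 1) (Measurable.aestronglyMeasurable (by fun_prop))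
      (ae_of_all _ fun ω => ?_)).sub ((Integrable.of_bound (C := Real.exp (c / 2))
      (Measurable.aestronglyMeasurable (by fun_prop)) (ae_of_all _ (hZnorm n))).const_mul _)
    rw [mul_comm, Complex.norm_exp_ofReal_mul_I]
  · exact ((Integrable.of_bound (C := Real.exp (c / 2))
      (Measurable.aestronglyMeasurable (by fun_prop)) (ae_of_all _ (hZnorm n))).const_mul _)

/-! ### Taylor estimates for the complex exponential -/

section Taylor

lemma norm_exp_I_sub_one_le (x : ℝ) : ‖Complex.exp (Complex.I * x) - 1‖ ≤ min |x| 2 := by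
  refine le_min ?_ ?_
  · simpa using Real.norm_exp_I_mul_ofReal_sub_one_le (x := x)
  · refine (norm_sub_le _ _).trans ?_
    rw [mul_comm, Complex.norm_exp_ofReal_mul_I]
    norm_num

/-- The remainder is quadratic for `|d| ≤ 1` and at most linear for `|d| ≥ 1`; since `1 ≤ ρ ≤ 2`,
the power `|d| ^ ρ` dominates both. -/
lemma norm_exp_I_sub_one_sub_le (d : ℝ) {ρ : ℝ} (hρ : ρ ∈ Set.Icc (1 : ℝ) 2) :
    ‖Complex.exp (Complex.I * d) - 1 - Complex.I * d‖ ≤ 3 * |d| ^ ρ := by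
  rcases le_total |d| 1 with h | h
  · have h1 := Complex.exp_bound (x := Complex.I * d) (by simpa using h) (n := 2) (by norm_num)
    simp only [Finset.sum_range_succ, Finset.sum_range_zero, norm_mul, Complex.norm_I,
      Complex.norm_real, Real.norm_eq_abs, one_mul] at h1
    norm_num at h1
    have h2 : |d| ^ (2 : ℝ) ≤ |d| ^ ρ := by
      rcases eq_or_lt_of_le (abs_nonneg d) with h0 | h0
      · rw [← h0, Real.zero_rpow two_ne_zero]; exact Real.rpow_nonneg le_rfl _
      · exact Real.rpow_le_rpow_of_exponent_ge h0 h hρ.2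
    rw [Real.rpow_two, sq_abs] at h2
    rw [sub_sub]
    refine h1.trans ?_
    nlinarith [sq_nonneg d]
  · have h1 : |d| ≤ |d| ^ ρ := by
      simpa using Real.rpow_le_rpow_of_exponent_le h hρ.1
    refine (norm_sub_le _ _).trans ?_
    have := (norm_exp_I_sub_one_le d).trans (min_le_right _ _)
    have h3 : ‖Complex.I * d‖ = |d| := by simp
    rw [h3]
    linarith

/-- The cubic remainder is at most `ε x²` when `|x| ≤ ε`. Larger values go into the indicator, which
becomes the Lindeberg term. -/
lemma norm_exp_I_sub_taylor_two_le (x : ℝ) {ε : ℝ} (h0 : 0 < ε) (hε1 : ε < 1) :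
    ‖Complex.exp (Complex.I * x) - 1 - Complex.I * x + (x : ℂ) ^ 2 / 2‖
      ≤ ε * x ^ 2 + {y : ℝ | ε < |y|}.indicator (fun y => 4 * y ^ 2) x := by
  rcases le_total |x| 1 with h | h
  · have h1 := Complex.exp_bound (x := Complex.I * x) (by simpa using h) (n := 3) (by norm_num)
    simp only [Finset.sum_range_succ, Finset.sum_range_zero, norm_mul, Complex.norm_I,
      Complex.norm_real, Real.norm_eq_abs, one_mul] at h1
    norm_num [Nat.factorial] at h1
    have h2 : ‖Complex.exp (Complex.I * x) - 1 - Complex.I * x + (x : ℂ) ^ 2 / 2‖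
        ≤ |x| * x ^ 2 := by
      have : Complex.exp (Complex.I * x) - 1 - Complex.I * x + (x : ℂ) ^ 2 / 2
          = Complex.exp (Complex.I * x) - (1 + Complex.I * x + (Complex.I * x) ^ 2 / 2) := by
        rw [mul_pow, Complex.I_sq]; ring
      rw [this]
      refine h1.trans ?_
      have : |x| ^ 3 = |x| * x ^ 2 := by rw [← sq_abs]; ring
      rw [this]
      nlinarith [mul_nonneg (abs_nonneg x) (sq_nonneg x)]
    by_cases hx : ε < |x|
    · rw [Set.indicator_of_mem (by exact hx)]
      nlinarith [sq_nonneg x]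
    · rw [Set.indicator_of_notMem (by exact hx)]
      nlinarith [sq_nonneg x]
  · have h1 := (norm_exp_I_sub_one_le x).trans (min_le_right _ _)
    have h3 : ‖Complex.I * x‖ = |x| := by simp
    have h4 : ‖(x : ℂ) ^ 2 / 2‖ = x ^ 2 / 2 := by simp
    have h5 : ‖Complex.exp (Complex.I * x) - 1 - Complex.I * x + (x : ℂ) ^ 2 / 2‖
        ≤ 2 + |x| + x ^ 2 / 2 := by
      refine (norm_add_le _ _).trans (add_le_add ((norm_sub_le _ _).trans (add_le_add h1 h3.le)) h4.le)
    rw [Set.indicator_of_mem (by exact hε1.trans_le h)]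
    have h6 : |x| ≤ x ^ 2 := by rw [← sq_abs]; nlinarith
    nlinarith [sq_nonneg x]

/-- This controls the cross term between the main variable and the perturbation: Young's inequality
for `|d| ≤ 1`, the bound `2` on the minimum for `|d| ≥ 1`. -/
lemma abs_mul_min_le (x d : ℝ) {ρ ε : ℝ} (hρ : ρ ∈ Set.Icc (1 : ℝ) 2) (h0 : 0 < ε) :
    |d| * min |x| 2 ≤ (2 + 1 / (4 * ε)) * |d| ^ ρ + ε * x ^ 2 := by
  have hd : 0 ≤ |d| ^ ρ := Real.rpow_nonneg (abs_nonneg d) _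
  have hε : 0 < 1 / (4 * ε) := by positivity
  rcases le_total |d| 1 with h | h
  · have h2 : d ^ 2 ≤ |d| ^ ρ := by
      rcases eq_or_lt_of_le (abs_nonneg d) with h0 | h0
      · rw [abs_eq_zero.1 h0.symm]
        rw [zero_pow two_ne_zero]; exact Real.rpow_nonneg (abs_nonneg _) _
      · rw [← sq_abs, ← Real.rpow_two]
        exact Real.rpow_le_rpow_of_exponent_ge h0 h hρ.2
    have h3 : |d| * |x| ≤ 1 / (4 * ε) * d ^ 2 + ε * x ^ 2 := by
      have : 1 / (4 * ε) * d ^ 2 + ε * x ^ 2 - |d| * |x| = (|d| - 2 * ε * |x|) ^ 2 / (4 * ε) := by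
        rw [← sq_abs d, ← sq_abs x]; field_simp; ring
      have h4 : 0 ≤ (|d| - 2 * ε * |x|) ^ 2 / (4 * ε) := by positivity
      linarith
    have h4 := mul_le_mul_of_nonneg_left (min_le_left |x| 2) (abs_nonneg d)
    have h5 := mul_le_mul_of_nonneg_left h2 hε.le
    linarith
  · have h1 : |d| ≤ |d| ^ ρ := by
      simpa using Real.rpow_le_rpow_of_exponent_le h hρ.1
    have h4 := mul_le_mul_of_nonneg_left (min_le_right |x| 2) (abs_nonneg d)
    have h5 : 0 ≤ ε * x ^ 2 := by positivity
    nlinarith [mul_nonneg hε.le hd]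

/-- Second order expansion of `exp (i (x + d))` with an error that is of order `ρ` in `d`. -/
lemma norm_exp_I_add_sub_taylor_le (x d : ℝ) {ρ ε : ℝ} (hρ : ρ ∈ Set.Icc (1 : ℝ) 2) (h0 : 0 < ε)
    (hε1 : ε < 1) :
    ‖Complex.exp (Complex.I * (x + d : ℝ)) - 1 - Complex.I * (x + d : ℝ) + (x : ℂ) ^ 2 / 2‖
      ≤ (5 + 1 / (4 * ε)) * |d| ^ ρ + 2 * ε * x ^ 2
        + {y : ℝ | ε < |y|}.indicator (fun y => 4 * y ^ 2) x := by
  -- The three summands are the expansion in `x`, the expansion in `d` rotated by `exp (i x)`, and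
  -- the cross term. The constants add up as `3 + 2 + 1 / (4 ε)` for `|d| ^ ρ` and `ε + ε` for `x²`.
  have e : Complex.exp (Complex.I * (x + d : ℝ)) - 1 - Complex.I * (x + d : ℝ) + (x : ℂ) ^ 2 / 2
      = (Complex.exp (Complex.I * x) - 1 - Complex.I * x + (x : ℂ) ^ 2 / 2)
        + Complex.exp (x * Complex.I) * (Complex.exp (Complex.I * d) - 1 - Complex.I * d)
        + Complex.I * d * (Complex.exp (Complex.I * x) - 1) := by
    push_cast
    rw [mul_add, Complex.exp_add, mul_comm (x : ℂ)]
    ring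
  rw [e]
  refine (norm_add₃_le).trans ?_
  have h1 := norm_exp_I_sub_taylor_two_le x h0 hε1
  have h2 := norm_exp_I_sub_one_sub_le d hρ
  have h3 := abs_mul_min_le x d hρ h0
  have h4 := mul_le_mul_of_nonneg_left (norm_exp_I_sub_one_le x) (abs_nonneg d)
  rw [norm_mul, Complex.norm_exp_ofReal_mul_I, norm_mul (Complex.I * d), norm_mul, Complex.norm_I,
    Complex.norm_real, Real.norm_eq_abs]
  linarith

lemma abs_one_sub_sub_exp_le {s : ℝ} (hs : 0 ≤ s) : |1 - s / 2 - Real.exp (-s / 2)| ≤ s ^ 2 := by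
  rcases le_total s 2 with h | h
  · have := Real.abs_exp_sub_one_sub_id_le (x := -s / 2) (by rw [abs_le]; constructor <;> linarith)
    rw [abs_sub_comm]
    refine le_trans (le_of_eq ?_) (this.trans (by nlinarith))
    congr 1; ring
  · have h1 := Real.exp_pos (-s / 2)
    have h2 : Real.exp (-s / 2) ≤ 1 := Real.exp_le_one_iff.2 (by linarith)
    rw [abs_le]
    constructor <;> nlinarith

end Taylor

/-! ### Conditional characteristic function of one increment -/

section OneStep

variable {Ω : Type*} {m mΩ : MeasurableSpace Ω} {μ : Measure Ω}

lemma le_one_add_rpow {x ρ : ℝ} (hx : 0 ≤ x) (hρ : 1 ≤ ρ) : x ≤ 1 + x ^ ρ := by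
  rcases le_total x 1 with h | h
  · have := Real.rpow_nonneg hx ρ; linarith
  · have := Real.rpow_le_rpow_of_exponent_le h hρ
    rw [Real.rpow_one] at this; linarith

/-- A bound on the `[0, ∞]`-valued conditional moment passes to the real-valued conditional
expectation once the moment has been truncated to an integrable variable. -/
lemma condExp_indicator_rpow_le {D b : Ω → ℝ} {ρ : ℝ} (hb0 : ∀ ω, 0 ≤ b ω)
    (hb : μ⁻[fun ω => ENNReal.ofReal (|D ω| ^ ρ) | m] ≤ᵐ[μ] fun ω => ENNReal.ofReal (b ω))
    {S : Set Ω} (hi : Integrable (S.indicator fun ω => |D ω| ^ ρ) μ) :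
    μ[S.indicator fun ω => |D ω| ^ ρ | m] ≤ᵐ[μ] b := by
  have h0 : ∀ ω, 0 ≤ S.indicator (fun ω => |D ω| ^ ρ) ω := fun ω =>
    Set.indicator_nonneg (fun _ _ => Real.rpow_nonneg (abs_nonneg _) _) _
  have h1 := toReal_condLExp m
    (f := fun ω => ENNReal.ofReal (S.indicator (fun ω => |D ω| ^ ρ) ω))
    hi.aestronglyMeasurable.aemeasurable.ennreal_ofReal
    ((hasFiniteIntegral_iff_ofReal (ae_of_all _ h0)).1 hi.2).ne
  have h2 : μ⁻[fun ω => ENNReal.ofReal (S.indicator (fun ω => |D ω| ^ ρ) ω) | m]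
      ≤ᵐ[μ] μ⁻[fun ω => ENNReal.ofReal (|D ω| ^ ρ) | m] := by
    refine condLExp_mono (ae_of_all _ fun ω => ENNReal.ofReal_le_ofReal ?_)
    exact Set.indicator_apply_le' (fun _ => le_rfl) fun _ => Real.rpow_nonneg (abs_nonneg _) _
  have h3 : (fun ω => (ENNReal.ofReal (S.indicator (fun ω => |D ω| ^ ρ) ω)).toReal)
      = S.indicator fun ω => |D ω| ^ ρ := by
    ext ω; exact ENNReal.toReal_ofReal (h0 ω)
  rw [h3] at h1
  filter_upwards [h1, h2, hb] with ω e1 e2 e3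
  rw [← e1, ← ENNReal.toReal_ofReal (hb0 ω)]
  exact ENNReal.toReal_mono ENNReal.ofReal_ne_top (e2.trans e3)

variable [IsProbabilityMeasure μ]

/-- On an event where the bound of the conditional moment is bounded, the moment is finite. -/
lemma integrable_indicator_rpow (hm : m ≤ mΩ) {D b : Ω → ℝ} {ρ : ℝ} (hD : AEStronglyMeasurable D μ)
    (hb : μ⁻[fun ω => ENNReal.ofReal (|D ω| ^ ρ) | m] ≤ᵐ[μ] fun ω => ENNReal.ofReal (b ω))
    {S : Set Ω} (hS : MeasurableSet[m] S) {R : ℝ} (hR : ∀ ω ∈ S, b ω ≤ R) :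
    Integrable (S.indicator fun ω => |D ω| ^ ρ) μ := by
  have hmeas : AEStronglyMeasurable (fun ω => |D ω| ^ ρ) μ :=
    (hD.aemeasurable.abs.pow_const ρ).aestronglyMeasurable
  rw [integrable_indicator_iff (hm S hS)]
  refine ⟨hmeas.restrict, ?_⟩
  have h1 : ∫⁻ ω in S, ENNReal.ofReal (|D ω| ^ ρ) ∂μ ≤ ∫⁻ _ in S, ENNReal.ofReal R ∂μ := by
    rw [← setLIntegral_condLExp hm _ _ hS]
    refine setLIntegral_mono_ae' (hm S hS) ?_
    filter_upwards [hb] with ω hω hωS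
    exact hω.trans (ENNReal.ofReal_le_ofReal (hR ω hωS))
  rw [hasFiniteIntegral_iff_ofReal (ae_of_all _ fun ω => Real.rpow_nonneg (abs_nonneg _) _)]
  refine h1.trans_lt ?_
  simp only [lintegral_const]
  exact ENNReal.mul_lt_top ENNReal.ofReal_lt_top (measure_lt_top _ _)

/-- Localized centering is what replaces a vanishing conditional expectation for variables that may
fail to be integrable; after truncation to a suitable `m`-measurable event the usual statement is
recovered. -/
lemma condExp_indicator_eq_zero (hm : m ≤ mΩ) {M : Ω → ℝ}
    (hM0 : ∀ S, MeasurableSet[m] S → IntegrableOn M S μ → ∫ ω in S, M ω ∂μ = 0) {S : Set Ω}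
    (hS : MeasurableSet[m] S) (hi : IntegrableOn M S μ) : μ[S.indicator M | m] =ᵐ[μ] 0 := by
  refine (ae_eq_condExp_of_forall_setIntegral_eq hm ((integrable_indicator_iff (hm S hS)).2 hi)
    (fun _ _ _ => integrableOn_zero) (fun t ht _ => ?_) aestronglyMeasurable_zero).symm
  rw [setIntegral_indicator (hm S hS), hM0 _ (ht.inter hS) (hi.mono_set Set.inter_subset_right)]
  simp

/-- Conditional characteristic function of a centered variable `M` that is close, in conditional
`ρ`-th moment, to a square integrable variable `χ`. The variable `M` itself is only centered on
events where it is integrable. -/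
lemma norm_condExp_exp_sub_le (hm : m ≤ mΩ) {M χ b : Ω → ℝ} {ρ ε : ℝ}
    (hρ : ρ ∈ Set.Icc (1 : ℝ) 2) (h0 : 0 < ε) (h1 : ε < 1) (u : ℝ)
    (hM : AEStronglyMeasurable M μ)
    (hM0 : ∀ S, MeasurableSet[m] S → IntegrableOn M S μ → ∫ ω in S, M ω ∂μ = 0)
    (hχ : MemLp χ 2 μ) (hbm : Measurable[m] b) (hb0 : ∀ ω, 0 ≤ b ω)
    (hb : μ⁻[fun ω => ENNReal.ofReal (|M ω - χ ω| ^ ρ) | m] ≤ᵐ[μ] fun ω => ENNReal.ofReal (b ω)) :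
    ∀ᵐ ω ∂μ, ‖(μ[fun ω => Complex.exp (Complex.I * (u * M ω : ℝ)) | m]) ω
        - Complex.exp (-((u ^ 2 * (μ[fun ω => χ ω ^ 2 | m]) ω : ℝ) : ℂ) / 2)‖
      ≤ (5 + 1 / (4 * ε)) * (|u| ^ ρ * b ω)
        + (2 * ε + ε ^ 2) * (u ^ 2 * (μ[fun ω => χ ω ^ 2 | m]) ω)
        + (4 + u ^ 2 * (μ[fun ω => χ ω ^ 2 | m]) ω)
          * (u ^ 2 * (μ[{ω | ε < |u * χ ω|}.indicator fun ω => χ ω ^ 2 | m]) ω) := by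
  have hχ2 : Integrable (fun ω => χ ω ^ 2) μ := hχ.integrable_sq
  have hset : NullMeasurableSet {ω | ε < |u * χ ω|} μ :=
    nullMeasurableSet_lt aemeasurable_const (hχ.aestronglyMeasurable.aemeasurable.const_mul u).abs
  have hχi : Integrable ({ω | ε < |u * χ ω|}.indicator fun ω => χ ω ^ 2) μ := hχ2.indicator₀ hset
  have hv0 : 0 ≤ᵐ[μ] μ[fun ω => χ ω ^ 2 | m] := condExp_nonneg (ae_of_all _ fun ω => sq_nonneg _)
  have hL0 : 0 ≤ᵐ[μ] μ[{ω | ε < |u * χ ω|}.indicator fun ω => χ ω ^ 2 | m] :=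
    condExp_nonneg (ae_of_all _ fun ω => Set.indicator_nonneg (fun _ _ => sq_nonneg _) _)
  -- the conditional variance is at most `ε ^ 2` up to the Lindeberg term
  have hvL : ∀ᵐ ω ∂μ, u ^ 2 * (μ[fun ω => χ ω ^ 2 | m]) ω
      ≤ ε ^ 2 + u ^ 2 * (μ[{ω | ε < |u * χ ω|}.indicator fun ω => χ ω ^ 2 | m]) ω := by
    have e1 := condExp_smul (μ := μ) (u ^ 2) (fun ω => χ ω ^ 2) m
    have e2 := condExp_smul (μ := μ) (u ^ 2) ({ω | ε < |u * χ ω|}.indicator fun ω => χ ω ^ 2) m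
    have e3 := condExp_add (μ := μ) (integrable_const (ε ^ 2)) (hχi.smul (u ^ 2)) m
    have e4 := condExp_mono (m := m) (hχ2.smul (u ^ 2))
      ((integrable_const (ε ^ 2)).add (hχi.smul (u ^ 2))) (ae_of_all μ fun ω => by
        by_cases hω : ε < |u * χ ω|
        · simp only [Pi.smul_apply, Pi.add_apply, smul_eq_mul]
          rw [Set.indicator_of_mem (by exact hω)]
          nlinarith [sq_nonneg ε]
        · simp only [Pi.smul_apply, Pi.add_apply, smul_eq_mul]
          rw [Set.indicator_of_notMem (by exact hω), mul_zero, add_zero, ← mul_pow, ← sq_abs]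
          exact pow_le_pow_left₀ (abs_nonneg _) (not_lt.1 hω) 2)
    rw [condExp_const hm] at e3
    filter_upwards [e1, e2, e3, e4] with ω e1 e2 e3 e4
    rw [e1, e3] at e4
    simp only [Pi.add_apply, Pi.smul_apply, smul_eq_mul, e2] at e4
    exact e4
  have hD : AEStronglyMeasurable (fun ω => M ω - χ ω) μ := hM.sub hχ.aestronglyMeasurable
  have hφi : Integrable (fun ω => Complex.exp (Complex.I * (u * M ω : ℝ))) μ := by
    have := hM.aemeasurable
    exact Integrable.of_bound (C := 1) (AEMeasurable.aestronglyMeasurable (by fun_prop))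
      (ae_of_all _ fun ω => by rw [mul_comm, Complex.norm_exp_ofReal_mul_I])
  -- The event `b ≤ R` belongs to `m`, and on it `M` is integrable. These events exhaust `Ω` as `R`
  -- grows, and the estimate does not depend on `R`.
  have hmain : ∀ R : ℕ, ∀ᵐ ω ∂μ, b ω ≤ R →
      ‖(μ[fun ω => Complex.exp (Complex.I * (u * M ω : ℝ)) | m]) ω
        - 1 + (u ^ 2 * (μ[fun ω => χ ω ^ 2 | m]) ω : ℝ) / 2‖
      ≤ (5 + 1 / (4 * ε)) * (|u| ^ ρ * b ω) + 2 * ε * (u ^ 2 * (μ[fun ω => χ ω ^ 2 | m]) ω)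
        + 4 * (u ^ 2 * (μ[{ω | ε < |u * χ ω|}.indicator fun ω => χ ω ^ 2 | m]) ω) := by
    intro R
    set S : Set Ω := {ω | b ω ≤ R} with hS_def
    have hS : MeasurableSet[m] S := measurableSet_le hbm measurable_const
    have hSm := hm S hS
    have hDρ := integrable_indicator_rpow hm hD hb hS (R := R) fun ω hω => hω
    have hDi : IntegrableOn (fun ω => M ω - χ ω) S μ := by
      rw [integrable_indicator_iff hSm] at hDρ
      refine ((integrable_const (1 : ℝ)).add hDρ).mono' hD.restrict (ae_of_all _ fun ω => ?_)
      exact le_one_add_rpow (abs_nonneg _) hρ.1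
    have hMi : IntegrableOn M S μ := by
      have := hDi.add (hχ.integrable one_le_two).integrableOn
      refine this.congr_fun (fun ω _ => ?_) hSm
      simp
    have hMz := condExp_indicator_eq_zero hm hM0 hS hMi
    have hDb := condExp_indicator_rpow_le hb0 hb hDρ
    set T1 : ℝ →L[ℝ] ℂ := (Complex.I * u) • Complex.ofRealCLM with hT1
    set T2 : ℝ →L[ℝ] ℂ := ((u : ℂ) ^ 2 / 2) • Complex.ofRealCLM with hT2
    set φ : Ω → ℂ := fun ω => Complex.exp (Complex.I * (u * M ω : ℝ)) with hφ
    -- The linear term is kept out of `r`, since `M` is only integrable after multiplication by the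
    -- indicator of `S`. It is subtracted in truncated form in `r'`, where its conditional
    -- expectation vanishes.
    set r : Ω → ℂ := (φ - fun _ => 1) + T2 ∘ fun ω => χ ω ^ 2 with hr
    have hri : Integrable r μ := (hφi.sub (integrable_const _)).add (T2.integrable_comp hχ2)
    have hMi' := (integrable_indicator_iff hSm).2 hMi
    have hT2i : Integrable (T2 ∘ fun ω => χ ω ^ 2) μ := T2.integrable_comp hχ2
    have hT1i : Integrable (T1 ∘ S.indicator M) μ := T1.integrable_comp hMi'
    have c1 := condExp_add (hφi.sub (integrable_const (1 : ℂ))) hT2i m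
    have c2 := condExp_sub hφi (integrable_const (μ := μ) (1 : ℂ)) m
    have c3 := T2.comp_condExp_comm (m := m) hχ2
    have c4 := condExp_sub (hri.indicator hSm) hT1i m
    have c5 := T1.comp_condExp_comm (m := m) hMi'
    have c6 := condExp_indicator (m := m) hri hS
    rw [condExp_const hm] at c2
    set B : Ω → ℝ := ((5 + 1 / (4 * ε)) * |u| ^ ρ) • (S.indicator fun ω => |M ω - χ ω| ^ ρ)
      + ((2 * ε * u ^ 2) • (fun ω => χ ω ^ 2)
        + (4 * u ^ 2) • ({ω | ε < |u * χ ω|}.indicator fun ω => χ ω ^ 2)) with hB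
    have hBi : Integrable B μ := (hDρ.smul _).add ((hχ2.smul _).add (hχi.smul _))
    have d1 := condExp_add (hDρ.smul ((5 + 1 / (4 * ε)) * |u| ^ ρ))
      ((hχ2.smul (2 * ε * u ^ 2)).add (hχi.smul (4 * u ^ 2))) m
    have d2 := condExp_add (hχ2.smul (2 * ε * u ^ 2)) (hχi.smul (4 * u ^ 2)) m
    have d3 := condExp_smul (μ := μ) ((5 + 1 / (4 * ε)) * |u| ^ ρ)
      (S.indicator fun ω => |M ω - χ ω| ^ ρ) m
    have d4 := condExp_smul (μ := μ) (2 * ε * u ^ 2) (fun ω => χ ω ^ 2) m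
    have d5 := condExp_smul (μ := μ) (4 * u ^ 2)
      ({ω | ε < |u * χ ω|}.indicator fun ω => χ ω ^ 2) m
    set r' : Ω → ℂ := S.indicator r - T1 ∘ S.indicator M with hr'
    have hr'i : Integrable r' μ := (hri.indicator hSm).sub hT1i
    have hpt : ∀ ω, ‖r' ω‖ ≤ B ω := by
      intro ω
      have hB2 : 0 ≤ 2 * ε * u ^ 2 * χ ω ^ 2 := by positivity
      have hB3 : 0 ≤ 4 * u ^ 2 * {ω | ε < |u * χ ω|}.indicator (fun ω => χ ω ^ 2) ω :=
        mul_nonneg (by positivity) (Set.indicator_nonneg (fun _ _ => sq_nonneg _) _)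
      by_cases hω : ω ∈ S
      · have e1 : r' ω = Complex.exp (Complex.I * (u * χ ω + u * (M ω - χ ω) : ℝ)) - 1
            - Complex.I * (u * χ ω + u * (M ω - χ ω) : ℝ) + ((u * χ ω : ℝ) : ℂ) ^ 2 / 2 := by
          simp only [hr', hr, hφ, hT1, hT2, Pi.sub_apply, Pi.add_apply, Function.comp_apply,
            Set.indicator_of_mem hω]
          simp
          ring_nf
        rw [e1]
        refine (norm_exp_I_add_sub_taylor_le (u * χ ω) (u * (M ω - χ ω)) hρ h0 h1).trans ?_
        simp only [hB, Pi.add_apply, Pi.smul_apply, smul_eq_mul, Set.indicator_of_mem hω]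
        rw [abs_mul, Real.mul_rpow (abs_nonneg _) (abs_nonneg _)]
        have e2 : {y : ℝ | ε < |y|}.indicator (fun y => 4 * y ^ 2) (u * χ ω)
            = 4 * u ^ 2 * {ω | ε < |u * χ ω|}.indicator (fun ω => χ ω ^ 2) ω := by
          by_cases hx : ε < |u * χ ω|
          · rw [Set.indicator_of_mem (by exact hx), Set.indicator_of_mem (by exact hx)]; ring
          · rw [Set.indicator_of_notMem (by exact hx), Set.indicator_of_notMem (by exact hx)]; ring
        rw [e2]
        exact le_of_eq (by ring)
      · simp only [hr', hB, Pi.sub_apply, Pi.add_apply, Function.comp_apply, Pi.smul_apply,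
          smul_eq_mul, Set.indicator_of_notMem hω, map_zero, sub_zero, norm_zero, mul_zero, zero_add]
        exact add_nonneg hB2 hB3
    have f1 := norm_condExp_le (m := m) (μ := μ) r'
    have f2 := condExp_mono (m := m) hr'i.norm hBi (ae_of_all μ hpt)
    filter_upwards [c1, c2, c3, c4, c5, c6, d1, d2, d3, d4, d5, f1, f2, hMz, hDb] with ω c1 c2 c3 c4
      c5 c6 d1 d2 d3 d4 d5 f1 f2 hMz hDb hω
    have g1 : (μ[r' | m]) ω = (μ[φ | m]) ω - 1
        + (u ^ 2 * (μ[fun ω => χ ω ^ 2 | m]) ω : ℝ) / 2 := by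
      rw [c4, Pi.sub_apply, c6, Set.indicator_of_mem (by exact hω), ← c5, Function.comp_apply, hMz,
        c1, Pi.add_apply, c2, ← c3]
      simp [hT1, hT2]
      ring
    rw [← g1]
    refine (f1.trans f2).trans ?_
    rw [d1, Pi.add_apply, d2, Pi.add_apply, d3, d4, d5]
    simp only [Pi.smul_apply, smul_eq_mul]
    have hK : 0 ≤ (5 + 1 / (4 * ε)) * |u| ^ ρ :=
      mul_nonneg (by positivity) (Real.rpow_nonneg (abs_nonneg _) _)
    have := mul_le_mul_of_nonneg_left hDb hK
    linarith
  filter_upwards [ae_all_iff.2 hmain, hvL, hv0, hL0] with ω hω hvL hv0 hL0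
  obtain ⟨R, hR⟩ := exists_nat_ge (b ω)
  have k1 := hω R hR
  set v := (μ[fun ω => χ ω ^ 2 | m]) ω
  set L := (μ[{ω | ε < |u * χ ω|}.indicator fun ω => χ ω ^ 2 | m]) ω
  set p := (μ[fun ω => Complex.exp (Complex.I * (u * M ω : ℝ)) | m]) ω
  have hv : 0 ≤ u ^ 2 * v := mul_nonneg (sq_nonneg _) hv0
  have k2 := abs_one_sub_sub_exp_le hv
  have k3 : p - Complex.exp (-((u ^ 2 * v : ℝ) : ℂ) / 2)
      = (p - 1 + (u ^ 2 * v : ℝ) / 2)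
        + ((1 - u ^ 2 * v / 2 - Real.exp (-(u ^ 2 * v) / 2) : ℝ) : ℂ) := by
    push_cast; ring
  rw [k3]
  refine (norm_add_le _ _).trans ?_
  rw [Complex.norm_real, Real.norm_eq_abs]
  -- Passing from `1 - s / 2` to `exp (-s / 2)` costs `s²` with `s = u² v`. Bounding one factor `s`
  -- by `ε² + u² L` makes this small: it yields the `ε²` and the product term of the claim.
  have k4 := mul_le_mul_of_nonneg_left hvL hv
  nlinarith

end OneStep

/-! ### Almost sure convergence of series of centered increments -/

/-- The function `√(1 + s²)` behaves like `|s|` at infinity, has slope at most `1` and bounded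
curvature. Its first-order remainder is therefore at most quadratic for small `d` and at most linear
for large `d`, so `|d| ^ ρ` controls it in both ranges. It serves as a smooth substitute for `|s|`
in the `L¹` bound of a martingale. -/
lemma sqrt_one_add_add_sq_le (s d : ℝ) {ρ : ℝ} (hρ : ρ ∈ Set.Icc (1 : ℝ) 2) :
    √(1 + (s + d) ^ 2) ≤ √(1 + s ^ 2) + s / √(1 + s ^ 2) * d + 2 * |d| ^ ρ := by
  set r := √(1 + s ^ 2) with hr
  have hr2 : r ^ 2 = 1 + s ^ 2 := Real.sq_sqrt (by positivity)
  have hr1 : 1 ≤ r := Real.one_le_sqrt.2 (by nlinarith [sq_nonneg s])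
  have hr0 : 0 < r := by linarith
  have hsr : |s / r| ≤ 1 := by
    rw [abs_div, abs_of_pos hr0, div_le_one hr0]
    exact Real.le_sqrt_of_sq_le (by rw [sq_abs]; linarith)
  have hd : 0 ≤ |d| ^ ρ := Real.rpow_nonneg (abs_nonneg d) _
  rcases le_total |d| 1 with h | h
  · have h2 : d ^ 2 ≤ |d| ^ ρ := by
      rcases eq_or_lt_of_le (abs_nonneg d) with h0 | h0
      · rw [abs_eq_zero.1 h0.symm, zero_pow two_ne_zero]
        exact Real.rpow_nonneg (abs_nonneg _) _
      · rw [← sq_abs, ← Real.rpow_two]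
        exact Real.rpow_le_rpow_of_exponent_ge h0 h hρ.2
    have h3 : √(1 + (s + d) ^ 2) ≤ r + s / r * d + d ^ 2 / (2 * r) := by
      have e : r + s / r * d + d ^ 2 / (2 * r) = r + (2 * s * d + d ^ 2) / (2 * r) := by
        field_simp; ring
      rw [e]
      refine Real.sqrt_le_iff.2 ⟨?_, ?_⟩
      · have : r + (2 * s * d + d ^ 2) / (2 * r) = (r ^ 2 + 1 + (s + d) ^ 2) / (2 * r) := by
          rw [hr2] ; field_simp; rw [hr2]; ring
        rw [this]; positivity
      · have : (r + (2 * s * d + d ^ 2) / (2 * r)) ^ 2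
            = r ^ 2 + (2 * s * d + d ^ 2) + ((2 * s * d + d ^ 2) / (2 * r)) ^ 2 := by
          field_simp; ring
        rw [this, hr2]
        nlinarith [sq_nonneg ((2 * s * d + d ^ 2) / (2 * r))]
    have h4 : d ^ 2 / (2 * r) ≤ d ^ 2 := div_le_self (sq_nonneg d) (by linarith)
    linarith
  · have h1 : |d| ≤ |d| ^ ρ := by
      simpa using Real.rpow_le_rpow_of_exponent_le h hρ.1
    have h3 : √(1 + (s + d) ^ 2) ≤ r + |d| := by
      refine Real.sqrt_le_iff.2 ⟨by positivity, ?_⟩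
      have : s * d ≤ r * |d| := by
        refine (le_abs_self _).trans ?_
        rw [abs_mul]
        refine mul_le_mul_of_nonneg_right ?_ (abs_nonneg d)
        exact Real.le_sqrt_of_sq_le (by rw [sq_abs]; linarith)
      have := sq_abs d
      nlinarith
    have h4 : -|d| ≤ s / r * d := by
      have : |s / r * d| ≤ |d| := by
        rw [abs_mul]; exact mul_le_of_le_one_left (abs_nonneg _) hsr
      exact (abs_le.1 this).1
    linarith

section Convergence

variable {Ω : Type*} {mΩ : MeasurableSpace Ω} {μ : Measure Ω} [IsProbabilityMeasure μ]
  {ℱ : Filtration ℕ mΩ}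

/-- A martingale whose increments have summable moments of order `ρ ∈ [1, 2]` converges. -/
lemma ae_exists_tendsto_sum_of_rpow_bound {D : ℕ → Ω → ℝ} {ρ N : ℝ} (hρ : ρ ∈ Set.Icc (1 : ℝ) 2)
    (hDm : ∀ k, StronglyMeasurable[ℱ (k + 1)] (D k)) (hDi : ∀ k, Integrable (D k) μ)
    (hDρ : ∀ k, Integrable (fun ω => |D k ω| ^ ρ) μ)
    (hD0 : ∀ k, μ[D k | ℱ k] =ᵐ[μ] 0)
    (hN : ∀ n, ∑ k ∈ Finset.range n, ∫ ω, |D k ω| ^ ρ ∂μ ≤ N) :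
    ∀ᵐ ω ∂μ, ∃ c, Tendsto (fun n => ∑ k ∈ Finset.range n, D k ω) atTop (𝓝 c) := by
  set S : ℕ → Ω → ℝ := fun n ω => ∑ k ∈ Finset.range n, D k ω with hS
  have hSm : ∀ n, StronglyMeasurable[ℱ n] (S n) := fun n =>
    Finset.stronglyMeasurable_fun_sum _ fun k hk =>
      (hDm k).mono (ℱ.mono (Finset.mem_range.1 hk))
  have hSi : ∀ n, Integrable (S n) μ := fun n => integrable_finsetSum _ fun k _ => hDi k
  have hmart : Martingale S ℱ μ := by
    refine martingale_of_condExp_sub_eq_zero_nat hSm hSi fun k => ?_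
    have : S (k + 1) - S k = D k := by
      ext ω; simp [hS, Finset.sum_range_succ]
    rw [this]; exact hD0 k
  have hone : ∀ x : ℝ, 1 ≤ √(1 + x ^ 2) := fun x =>
    Real.one_le_sqrt.2 (by nlinarith [sq_nonneg x])
  have habs : ∀ x : ℝ, |x| ≤ √(1 + x ^ 2) := fun x =>
    Real.le_sqrt_of_sq_le (by rw [sq_abs]; linarith)
  have hle : ∀ x : ℝ, √(1 + x ^ 2) ≤ 1 + |x| := fun x =>
    Real.sqrt_le_iff.2 ⟨by positivity, by nlinarith [sq_abs x, abs_nonneg x]⟩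
  have hφi : ∀ n, Integrable (fun ω => √(1 + S n ω ^ 2)) μ := fun n => by
    refine ((integrable_const (1 : ℝ)).add (hSi n).abs).mono' ?_ (ae_of_all _ fun ω => ?_)
    · have := (hSi n).aestronglyMeasurable.aemeasurable
      exact AEMeasurable.aestronglyMeasurable (by fun_prop)
    · rw [Real.norm_of_nonneg (Real.sqrt_nonneg _)]; exact hle _
  have hbound : ∀ n, ∫ ω, √(1 + S n ω ^ 2) ∂μ
      ≤ 1 + 2 * ∑ k ∈ Finset.range n, ∫ ω, |D k ω| ^ ρ ∂μ := by
    intro n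
    induction n with
    | zero => simp [hS]
    | succ n ih =>
      -- `ψ` is the derivative of `√(1 + x²)` at `S n`. It is bounded by `1` and known at time `n`,
      -- so the first-order term `ψ * D n` has mean zero, and each step adds at most twice the
      -- `ρ`-th moment.
      set ψ : Ω → ℝ := fun ω => S n ω / √(1 + S n ω ^ 2) with hψ
      have hψm : StronglyMeasurable[ℱ n] ψ := by
        have : Measurable fun x : ℝ => x / √(1 + x ^ 2) := by fun_prop
        exact (this.comp (hSm n).measurable).stronglyMeasurable
      have hψb : ∀ ω, ‖ψ ω‖ ≤ 1 := fun ω => by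
        have h0 := (zero_lt_one.trans_le (hone (S n ω)))
        rw [Real.norm_eq_abs, hψ, abs_div, abs_of_pos h0, div_le_one h0]
        exact habs _
      have hψD : Integrable (ψ * D n) μ :=
        (hDi n).bdd_mul (hψm.mono (ℱ.le n)).aestronglyMeasurable (ae_of_all _ hψb)
      have hz : ∫ ω, ψ ω * D n ω ∂μ = 0 := by
        have h1 := condExp_mul_of_stronglyMeasurable_left hψm hψD (hDi n)
        change ∫ ω, (ψ * D n) ω ∂μ = 0
        rw [← integral_condExp (ℱ.le n), integral_congr_ae h1]
        refine integral_eq_zero_of_ae ?_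
        filter_upwards [hD0 n] with ω hω
        simp [hω]
      have hψD' : Integrable (fun ω => ψ ω * D n ω) μ := hψD
      have hsumi : Integrable (fun ω => √(1 + S n ω ^ 2) + ψ ω * D n ω) μ := (hφi n).add hψD'
      calc ∫ ω, √(1 + S (n + 1) ω ^ 2) ∂μ
          ≤ ∫ ω, (√(1 + S n ω ^ 2) + ψ ω * D n ω + 2 * |D n ω| ^ ρ) ∂μ := by
            refine integral_mono (hφi _) (hsumi.add ((hDρ n).const_mul 2)) fun ω => ?_
            simp only [hS, Finset.sum_range_succ]
            exact sqrt_one_add_add_sq_le _ _ hρ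
        _ = ∫ ω, √(1 + S n ω ^ 2) ∂μ + 2 * ∫ ω, |D n ω| ^ ρ ∂μ := by
            rw [integral_add hsumi ((hDρ n).const_mul 2),
              integral_add (hφi n) hψD', hz, add_zero, integral_const_mul]
        _ ≤ _ := by
            rw [Finset.sum_range_succ, mul_add]; linarith
  refine hmart.submartingale.exists_ae_tendsto_of_bdd (R := (1 + 2 * N).toNNReal) fun n => ?_
  rw [eLpNorm_one_eq_lintegral_enorm, ← ofReal_integral_norm_eq_lintegral_enorm (hSi n)]
  refine ENNReal.ofReal_le_ofReal ?_
  calc ∫ ω, ‖S n ω‖ ∂μ ≤ ∫ ω, √(1 + S n ω ^ 2) ∂μ :=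
        integral_mono (hSi n).norm (hφi n) fun ω => habs _
    _ ≤ _ := (hbound n).trans (by linarith [hN n])

/-- A series of centered increments whose conditional moments of order `ρ ∈ [1, 2]` are almost
surely summable converges almost surely. The increments need not be integrable. -/
theorem ae_exists_tendsto_sum_of_summable {D v : ℕ → Ω → ℝ} {ρ : ℝ} (hρ : ρ ∈ Set.Icc (1 : ℝ) 2)
    (hDm : ∀ k, StronglyMeasurable[ℱ (k + 1)] (D k))
    (hD0 : ∀ k S, MeasurableSet[ℱ k] S → IntegrableOn (D k) S μ → ∫ ω in S, D k ω ∂μ = 0)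
    (hvm : ∀ k, Measurable[ℱ k] (v k)) (hv0 : ∀ k ω, 0 ≤ v k ω)
    (hb : ∀ k, μ⁻[fun ω => ENNReal.ofReal (|D k ω| ^ ρ) | ℱ k]
      ≤ᵐ[μ] fun ω => ENNReal.ofReal (v k ω))
    (hv : ∀ᵐ ω ∂μ, Summable fun k => v k ω) :
    ∀ᵐ ω ∂μ, ∃ c, Tendsto (fun n => ∑ k ∈ Finset.range n, D k ω) atTop (𝓝 c) := by
  have hρ0 : ρ ≠ 0 := by have := hρ.1; positivity
  have hloc : ∀ N : ℕ, ∀ᵐ ω ∂μ, (∀ n, ∑ k ∈ Finset.range n, v k ω ≤ N) →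
      ∃ c, Tendsto (fun n => ∑ k ∈ Finset.range n, D k ω) atTop (𝓝 c) := by
    intro N
    -- Predictable localization: the cut series has total moment at most `N`, and it agrees with the
    -- original one wherever all partial sums of `v` stay below `N`.
    set A : ℕ → Set Ω := fun k => {ω | ∑ j ∈ Finset.range (k + 1), v j ω ≤ N} with hA_def
    have hA : ∀ k, MeasurableSet[ℱ k] (A k) := fun k =>
      measurableSet_le (Finset.measurable_sum _ fun j hj =>
        (hvm j).mono (ℱ.mono (Nat.lt_succ_iff.1 (Finset.mem_range.1 hj))) le_rfl) measurable_const
    have hAm : ∀ k, MeasurableSet (A k) := fun k => ℱ.le k _ (hA k)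
    have hvm' : ∀ k, Measurable (v k) := fun k => (hvm k).mono (ℱ.le k) le_rfl
    have hDs : ∀ k, AEStronglyMeasurable (D k) μ := fun k =>
      ((hDm k).mono (ℱ.le _)).aestronglyMeasurable
    have hvA : ∀ k, ∀ ω ∈ A k, v k ω ≤ N := fun k ω hω =>
      (Finset.single_le_sum (f := fun j => v j ω) (fun j _ => hv0 j ω)
        (Finset.self_mem_range_succ k)).trans hω
    have hρi : ∀ k, Integrable ((A k).indicator fun ω => |D k ω| ^ ρ) μ := fun k =>
      integrable_indicator_rpow (ℱ.le k) (hDs k) (hb k) (hA k) (hvA k)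
    have hpow : ∀ k, (fun ω => |(A k).indicator (D k) ω| ^ ρ)
        = (A k).indicator fun ω => |D k ω| ^ ρ := fun k => by
      ext ω
      by_cases hω : ω ∈ A k
      · simp [hω]
      · simp [hω, Real.zero_rpow hρ0]
    have hDon : ∀ k, IntegrableOn (D k) (A k) μ := fun k => by
      have h := (integrable_indicator_iff (hAm k)).1 (hρi k)
      refine ((integrable_const (1 : ℝ)).add h).mono' (hDs k).restrict (ae_of_all _ fun ω => ?_)
      exact le_one_add_rpow (abs_nonneg _) hρ.1
    have hvi : ∀ k, Integrable ((A k).indicator (v k)) μ := fun k => by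
      refine Integrable.of_bound (C := N) ((hvm' k).indicator (hAm k)).aestronglyMeasurable
        (ae_of_all _ fun ω => ?_)
      rw [Real.norm_of_nonneg (Set.indicator_nonneg (fun _ _ => hv0 k _) _)]
      exact Set.indicator_apply_le' (hvA k ω) fun _ => N.cast_nonneg
    have hcut : ∀ n ω, ∑ k ∈ Finset.range n, (A k).indicator (v k) ω ≤ N := by
      intro n ω
      induction n with
      | zero => simp
      | succ n ih =>
        by_cases hω : ω ∈ A n
        · refine (Finset.sum_le_sum fun j _ => ?_).trans hω
          exact Set.indicator_apply_le' (fun _ => le_rfl) fun _ => hv0 j ω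
        · simpa [Finset.sum_range_succ, hω] using ih
    have hmom : ∀ k, ∫ ω, |(A k).indicator (D k) ω| ^ ρ ∂μ ≤ ∫ ω, (A k).indicator (v k) ω ∂μ := by
      intro k
      rw [hpow k, integral_indicator (hAm k), integral_indicator (hAm k)]
      have h1 := (integrable_indicator_iff (hAm k)).1 (hρi k)
      have h2 := (integrable_indicator_iff (hAm k)).1 (hvi k)
      rw [← ENNReal.ofReal_le_ofReal_iff (integral_nonneg fun ω => hv0 k ω),
        ofReal_integral_eq_lintegral_ofReal h1
          (ae_of_all _ fun ω => Real.rpow_nonneg (abs_nonneg _) _),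
        ofReal_integral_eq_lintegral_ofReal h2 (ae_of_all _ fun ω => hv0 k ω),
        ← setLIntegral_condLExp (ℱ.le k) _ _ (hA k)]
      exact setLIntegral_mono_ae' (hAm k) ((hb k).mono fun ω hω _ => hω)
    have hconv := ae_exists_tendsto_sum_of_rpow_bound (ℱ := ℱ) (μ := μ) (N := N) hρ
      (D := fun k => (A k).indicator (D k))
      (fun k => (hDm k).indicator (ℱ.mono k.le_succ _ (hA k)))
      (fun k => (integrable_indicator_iff (hAm k)).2 (hDon k))
      (fun k => by rw [hpow k]; exact hρi k)
      (fun k => condExp_indicator_eq_zero (ℱ.le k) (hD0 k) (hA k) (hDon k))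
      (fun n => by
        refine (Finset.sum_le_sum fun k _ => hmom k).trans ?_
        rw [← integral_finsetSum _ fun k _ => hvi k]
        refine (integral_mono (integrable_finsetSum _ fun k _ => hvi k) (integrable_const (N : ℝ))
          fun ω => hcut n ω).trans ?_
        simp)
    filter_upwards [hconv] with ω ⟨c, hc⟩ hω
    refine ⟨c, hc.congr fun n => Finset.sum_congr rfl fun k _ => ?_⟩
    exact Set.indicator_of_mem (show ω ∈ A k from hω (k + 1)) _
  filter_upwards [ae_all_iff.2 hloc, hv] with ω hω hs
  obtain ⟨N, hN⟩ := exists_nat_ge (∑' k, v k ω)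
  exact hω N fun n => (hs.sum_le_tsum _ fun k _ => hv0 k ω).trans hN

end Convergence

/-- Kronecker's lemma. -/
lemma tendsto_sum_div_of_tendsto_sum_div {b x : ℕ → ℝ} {c : ℝ} (hb : Monotone b)
    (hb0 : ∀ n, 0 < b (n + 1)) (hbt : Tendsto b atTop atTop)
    (hx : Tendsto (fun n => ∑ k ∈ Finset.range n, x k / b (k + 1)) atTop (𝓝 c)) :
    Tendsto (fun n => (∑ k ∈ Finset.range n, x k) / b n) atTop (𝓝 0) := by
  set s : ℕ → ℝ := fun n => ∑ k ∈ Finset.range n, x k / b (k + 1) with hs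
  -- Abel summation around the limit `c`. The middle sum averages the null sequence `s k - c`
  -- against the increments of `b`, hence is `o(b n)`. Positivity of `b 0` is not needed; in the
  -- applications `b 0 = 0`.
  have habel : ∀ n, ∑ k ∈ Finset.range n, x k
      = b n * (s n - c) - ∑ k ∈ Finset.range n, (b (k + 1) - b k) * (s k - c) + b 0 * c := by
    intro n
    induction n with
    | zero => simp [hs]
    | succ n ih =>
      have hne := (hb0 n).ne'
      have h1 : s (n + 1) = s n + x n / b (n + 1) := by simp [hs, Finset.sum_range_succ]
      rw [Finset.sum_range_succ, Finset.sum_range_succ, ih, h1]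
      have : b (n + 1) * (s n + x n / b (n + 1) - c) = b (n + 1) * (s n - c) + x n := by
        field_simp
        ring
      rw [this]; ring
  have hsc : Tendsto (fun n => s n - c) atTop (𝓝 0) := by simpa using hx.sub_const c
  have htel : ∀ n, ∑ k ∈ Finset.range n, (b (k + 1) - b k) = b n - b 0 := fun n =>
    Finset.sum_range_sub b n
  have hlo : (fun k => (b (k + 1) - b k) * (s k - c)) =o[atTop] fun k => b (k + 1) - b k := by
    have := (Asymptotics.isBigO_refl (fun k => b (k + 1) - b k) atTop).mul_isLittleO
      ((Asymptotics.isLittleO_one_iff ℝ).2 hsc)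
    simpa using this
  have hsum := hlo.sum_range (fun k => sub_nonneg.2 (hb k.le_succ))
    (by simp_rw [htel]; exact tendsto_atTop_add_const_right _ _ hbt)
  simp_rw [htel] at hsum
  have hO : (fun n => b n - b 0) =O[atTop] b := by
    refine (Asymptotics.isBigO_refl b atTop).sub ?_
    exact (Asymptotics.isLittleO_const_left.2
      (Or.inr (tendsto_norm_atTop_atTop.comp hbt))).isBigO
  have h1 := (hsum.trans_isBigO hO).tendsto_div_nhds_zero
  have h2 : Tendsto (fun n => b 0 * c / b n) atTop (𝓝 0) := hbt.const_div_atTop _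
  have h3 := (hsc.sub h1).add h2
  simp only [sub_zero, add_zero] at h3
  refine h3.congr' ?_
  filter_upwards [hbt.eventually_gt_atTop 0] with n hn
  rw [habel n]
  field_simp

/-! ### Elementary facts on weights and steps -/

section Weights

lemma sum_Icc_one_eq_sum_range (u : ℕ → ℝ) (n : ℕ) :
    ∑ k ∈ Finset.Icc 1 n, u k = ∑ k ∈ Finset.range n, u (k + 1) := by
  induction n with
  | zero => simp
  | succ n ih => rw [Finset.sum_Icc_succ_top (by omega), ih, Finset.sum_range_succ]

lemma cumWeight_eq_sum_range (w : ℕ → ℝ) (n : ℕ) :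
    cumWeight w n = ∑ k ∈ Finset.range n, w (k + 1) :=
  sum_Icc_one_eq_sum_range w n

lemma cumWeight_succ (w : ℕ → ℝ) (n : ℕ) : cumWeight w (n + 1) = cumWeight w n + w (n + 1) := by
  simp [cumWeight_eq_sum_range, Finset.sum_range_succ]

lemma empMean_eq_sum_range {E : Type*} (w : ℕ → ℝ) (x : ℕ → E) (n : ℕ) (f : E → ℝ) :
    empMean w x n f = (cumWeight w n)⁻¹ * ∑ k ∈ Finset.range n, w (k + 1) * f (x k) := by
  simp [empMean, sum_Icc_one_eq_sum_range]

lemma IsWeight.cumWeight_monotone {w : ℕ → ℝ} (hw : IsWeight w) : Monotone (cumWeight w) :=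
  monotone_nat_of_le_succ fun n => by
    rw [cumWeight_succ]; linarith [hw.nonneg (n + 1) (by omega)]

lemma IsWeight.cumWeight_nonneg {w : ℕ → ℝ} (hw : IsWeight w) (n : ℕ) : 0 ≤ cumWeight w n := by
  rw [cumWeight_eq_sum_range]
  exact Finset.sum_nonneg fun k _ => hw.nonneg _ (by omega)

/-- Weights `φ (γ n)` of infinite mass that are monotone functions of the steps are positive. -/
lemma IsRate.pos {φ : ℝ → ℝ} {γ : ℕ → ℝ} (hφ : IsRate φ) (hγ : IsStepSequence γ)
    (hw : IsWeight fun n => φ (γ n)) {n : ℕ} (hn : 1 ≤ n) : 0 < φ (γ n) := by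
  refine (hw.nonneg n hn).lt_of_ne fun h0 => ?_
  -- If `φ (γ n) = 0`, monotonicity makes `φ (γ k)` vanish as soon as `γ k ≤ γ n`, hence for all
  -- large `k`, and the total mass would be finite.
  obtain ⟨N, hN⟩ := eventually_atTop.1 (hγ.tendsto_zero.eventually_le_const (hγ.pos n hn))
  have hz : ∀ k, N + 1 ≤ k → φ (γ k) = 0 := fun k hk => by
    refine le_antisymm ?_ (hw.nonneg k (by omega))
    rw [h0]
    exact hφ.mono (hγ.pos k (by omega)).le (hγ.pos n hn).le (hN k (by omega))
  have hconst : ∀ k, cumWeight (fun n => φ (γ n)) (N + k) = cumWeight (fun n => φ (γ n)) N := by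
    intro k
    induction k with
    | zero => rfl
    | succ k ih => rw [← add_assoc, cumWeight_succ, ih, hz _ (by omega), add_zero]
  obtain ⟨k, hk⟩ := (tendsto_atTop.1 hw.tendsto_cumWeight
    (cumWeight (fun n => φ (γ n)) N + 1)).exists_forall_of_atTop
  have := hk (N + k) (by omega)
  rw [hconst] at this
  linarith

lemma cumWeight_rate_pos {φ : ℝ → ℝ} {γ : ℕ → ℝ} (hφ : IsRate φ) (hγ : IsStepSequence γ)
    (hw : IsWeight fun n => φ (γ n)) (n : ℕ) : 0 < cumWeight (fun n => φ (γ n)) (n + 1) := by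
  rw [cumWeight_succ]
  exact add_pos_of_nonneg_of_pos (hw.cumWeight_nonneg n) (hφ.pos hγ hw (by omega))

lemma IsStepSequence.mem_Ioc {γ : ℕ → ℝ} (hγ : IsStepSequence γ) (n : ℕ) :
    γ (n + 1) ∈ Set.Ioc 0 (stepSup γ) := by
  refine ⟨hγ.pos _ (by omega), le_ciSup (f := fun n => γ (n + 1)) ?_ n⟩
  exact (hγ.tendsto_zero.comp (tendsto_add_atTop_nat 1)).bddAbove_range

end Weights

/-! ### Averaging the error of the weak expansion along a path -/

section ErrorMean

variable {E Ω' : Type*} [TopologicalSpace E] [MeasurableSpace Ω']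
  {μ' : Measure Ω'} {γ : ℕ → ℝ} {g : E → ℝ} {L : E → ℝ → Ω' → ℝ}

/-- Under the first smallness property `L` itself tends to zero along the path: off a large compact
set it is small for all small steps, and on that set it is small once the step is small. Under the
second, the product `g L` tends to zero. Comparison with `g + 1` covers both. -/
lemma isLittleO_of_small (hγ : IsStepSequence γ) (x : ℕ → E)
    (hg0 : ∀ x, 0 ≤ g x) (hL0 : ∀ x s v, 0 ≤ L x s v)
    (hL : SmallI μ' (stepSup γ) L ∨ SmallII μ' g L) :
    ∀ᵐ v ∂μ', (fun k => g (x k) * L (x k) (γ (k + 1)) v) =o[atTop] fun k => g (x k) + 1 := by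
  have hγ0 : Tendsto (fun k => γ (k + 1)) atTop (𝓝[>] 0) :=
    tendsto_nhdsWithin_iff.2 ⟨hγ.tendsto_zero.comp (tendsto_add_atTop_nat 1),
      .of_forall fun k => hγ.pos _ (by omega)⟩
  rcases hL with ⟨γlow, -, hlow, hL⟩ | hL
  · filter_upwards [hL] with v ⟨hK, hinf⟩
    refine Asymptotics.isLittleO_iff.2 fun ε hε => ?_
    obtain ⟨K, hKc, hKsub⟩ := mem_cocompact.1 (Metric.tendstoUniformlyOn_iff.1 hinf ε hε)
    have h1 := hγ0.eventually (Metric.tendstoUniformlyOn_iff.1 (hK K hKc) ε hε)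
    have h2 : ∀ᶠ k in atTop, γ (k + 1) ≤ γlow v :=
      (hγ.tendsto_zero.comp (tendsto_add_atTop_nat 1)).eventually_le_const (hlow v).1
    filter_upwards [h1, h2] with k hk1 hk2
    have hle : L (x k) (γ (k + 1)) v ≤ ε := by
      by_cases hx : x k ∈ K
      · have := hk1 (x k) hx
        simp only [Pi.zero_apply, dist_zero_left, Real.norm_eq_abs] at this
        exact (le_abs_self _).trans this.le
      · have := hKsub hx (γ (k + 1)) ⟨hγ.pos _ (by omega), hk2⟩
        simp only [Pi.zero_apply, dist_zero_left, Real.norm_eq_abs] at this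
        exact (le_abs_self _).trans this.le
    rw [Real.norm_of_nonneg (mul_nonneg (hg0 _) (hL0 _ _ _)),
      Real.norm_of_nonneg (by linarith [hg0 (x k)])]
    nlinarith [hg0 (x k)]
  · filter_upwards [hL] with v hv
    refine Asymptotics.isLittleO_iff.2 fun ε hε => ?_
    filter_upwards [hγ0.eventually (Metric.tendstoUniformly_iff.1 hv ε hε)] with k hk
    have := hk (x k)
    simp only [Pi.zero_apply, dist_zero_left] at this
    rw [mul_comm, Real.norm_of_nonneg (by linarith [hg0 (x k)] : 0 ≤ g (x k) + 1)]
    nlinarith [hg0 (x k)]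

/-- For a fixed auxiliary point `v`, the weighted mean of an `o(g + 1)` sequence vanishes because
the weighted means of `g + 1` are bounded. Dominated convergence, with a multiple of `Y` as
majorant, then handles the integral over `v`. -/
lemma tendsto_weighted_error [MeasurableSpace E] {w : ℕ → ℝ} (hw : IsWeight w) (hγ : IsStepSequence γ) (x : ℕ → E)
    (hg0 : ∀ x, 0 ≤ g x) (hL0 : ∀ x s v, 0 ≤ L x s v)
    (hLm : Measurable fun p : E × ℝ × Ω' => L p.1 p.2.1 p.2.2)
    (hLd : ∃ Y : Ω' → ℝ, Integrable Y μ' ∧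
      ∀ᵐ v ∂μ', ∀ x, ∀ s ∈ Set.Ioc 0 (stepSup γ), L x s v ≤ Y v)
    (hL : SmallI μ' (stepSup γ) L ∨ SmallII μ' g L)
    (hgb : BddAbove (Set.range fun n : ℕ => empMean w x (n + 1) g)) :
    Tendsto (fun n => (cumWeight w n)⁻¹ * ∑ k ∈ Finset.range n,
      w (k + 1) * (g (x k) * ∫ v, L (x k) (γ (k + 1)) v ∂μ')) atTop (𝓝 0) := by
  obtain ⟨Y, hY, hLY⟩ := hLd
  obtain ⟨B, hB⟩ := hgb
  have hH0 := hw.cumWeight_nonneg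
  have hw0 : ∀ k, 0 ≤ w (k + 1) := fun k => hw.nonneg _ (by omega)
  have hBn : ∀ n, (cumWeight w n)⁻¹ * ∑ k ∈ Finset.range n, w (k + 1) * g (x k) ≤ |B| := by
    intro n
    cases n with
    | zero => simp
    | succ n =>
      rw [← empMean_eq_sum_range]
      exact (hB ⟨n, rfl⟩).trans (le_abs_self B)
  have hLs : ∀ x s, Measurable fun v => L x s v := fun x s =>
    hLm.comp (measurable_const.prodMk (measurable_const.prodMk measurable_id))
  have hLi : ∀ k, Integrable (fun v => L (x k) (γ (k + 1)) v) μ' := fun k =>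
    hY.mono' (hLs _ _).aestronglyMeasurable (hLY.mono fun v hv => by
      rw [Real.norm_of_nonneg (hL0 _ _ _)]; exact hv _ _ (hγ.mem_Ioc k))
  have hterm : ∀ k v, 0 ≤ w (k + 1) * (g (x k) * L (x k) (γ (k + 1)) v) := fun k v =>
    mul_nonneg (hw0 k) (mul_nonneg (hg0 _) (hL0 _ _ _))
  have key : Tendsto (fun n => ∫ v, (cumWeight w n)⁻¹ * ∑ k ∈ Finset.range n,
      w (k + 1) * (g (x k) * L (x k) (γ (k + 1)) v) ∂μ') atTop (𝓝 (∫ _, (0 : ℝ) ∂μ')) := by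
    refine tendsto_integral_of_dominated_convergence (fun v => |B| * Y v) (fun n => ?_)
      (hY.const_mul _) (fun n => ?_) ?_
    · have := hLs
      exact Measurable.aestronglyMeasurable (by fun_prop)
    · filter_upwards [hLY] with v hv
      rw [Real.norm_of_nonneg
        (mul_nonneg (inv_nonneg.2 (hH0 n)) (Finset.sum_nonneg fun k _ => hterm k v))]
      have hYv : 0 ≤ Y v := (hL0 _ _ _).trans (hv (x 0) _ (hγ.mem_Ioc 0))
      calc (cumWeight w n)⁻¹ * ∑ k ∈ Finset.range n, w (k + 1) * (g (x k) * L (x k) (γ (k + 1)) v)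
          ≤ (cumWeight w n)⁻¹ * ∑ k ∈ Finset.range n, w (k + 1) * g (x k) * Y v := by
            refine mul_le_mul_of_nonneg_left (Finset.sum_le_sum fun k _ => ?_)
              (inv_nonneg.2 (hH0 n))
            rw [← mul_assoc]
            exact mul_le_mul_of_nonneg_left (hv _ _ (hγ.mem_Ioc k)) (mul_nonneg (hw0 k) (hg0 _))
        _ = ((cumWeight w n)⁻¹ * ∑ k ∈ Finset.range n, w (k + 1) * g (x k)) * Y v := by
            rw [← Finset.sum_mul, mul_assoc]
        _ ≤ |B| * Y v := mul_le_mul_of_nonneg_right (hBn n) hYv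
    · filter_upwards [isLittleO_of_small hγ x hg0 hL0 hL] with v hv
      have h1 : (fun k => w (k + 1) * (g (x k) * L (x k) (γ (k + 1)) v))
          =o[atTop] fun k => w (k + 1) * (g (x k) + 1) :=
        (Asymptotics.isBigO_refl (fun k => w (k + 1)) atTop).mul_isLittleO hv
      have hge : ∀ n, cumWeight w n ≤ ∑ k ∈ Finset.range n, w (k + 1) * (g (x k) + 1) := fun n => by
        rw [cumWeight_eq_sum_range]
        exact Finset.sum_le_sum fun k _ => by nlinarith [mul_nonneg (hw0 k) (hg0 (x k))]
      have h2 := h1.sum_range (fun k => mul_nonneg (hw0 k) (by linarith [hg0 (x k)]))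
        (tendsto_atTop_mono hge hw.tendsto_cumWeight)
      have h3 : (fun n => ∑ k ∈ Finset.range n, w (k + 1) * (g (x k) + 1))
          =O[atTop] cumWeight w := by
        refine Asymptotics.IsBigO.of_bound (|B| + 1) ?_
        filter_upwards [hw.tendsto_cumWeight.eventually_gt_atTop 0] with n hn
        rw [Real.norm_of_nonneg ((hH0 n).trans (hge n)), Real.norm_of_nonneg (hH0 n)]
        have := hBn n
        rw [inv_mul_le_iff₀ hn] at this
        simp only [mul_add, mul_one, Finset.sum_add_distrib, ← cumWeight_eq_sum_range]
        linarith
      refine (h2.trans_isBigO h3).tendsto_div_nhds_zero.congr fun n => ?_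
      rw [div_eq_inv_mul]
  rw [integral_zero] at key
  refine key.congr fun n => ?_
  rw [integral_const_mul, integral_finsetSum _ fun k _ => ((hLi k).const_mul _).const_mul _]
  simp_rw [integral_const_mul]

end ErrorMean

/-! ### The increments as functions of two successive states -/

section Increments

variable {E : Type*} [MeasurableSpace E]

/-- The increment `martIncr` as a function of two successive states, for a step of size `s`. -/
noncomputable def incrFun (Q : ℝ → Kernel E E) (A : (E → ℝ) →ₗ.[ℝ] (E → ℝ)) (f : E → ℝ) (s : ℝ)
    (p : E × E) : ℝ :=
  -(f p.2 - kernelAvg (Q s) f p.1) +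
    s / 2 * (opApply A f p.2 - kernelAvg (Q s) (opApply A f) p.1)

lemma measurable_kernelAvg (κ : Kernel E E) {f : E → ℝ} (hf : Measurable f) :
    Measurable (kernelAvg κ f) :=
  (hf.stronglyMeasurable.integral_kernel).measurable

variable {Q : ℝ → Kernel E E} {A : (E → ℝ) →ₗ.[ℝ] (E → ℝ)} {f : E → ℝ}

lemma measurable_incrFun (hf : Measurable f) (ha : Measurable (opApply A f)) (s : ℝ) :
    Measurable (incrFun Q A f s) := by
  have h1 := measurable_kernelAvg (Q s) hf
  have h2 := measurable_kernelAvg (Q s) ha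
  unfold incrFun
  fun_prop

lemma integral_incrFun (s : ℝ) [IsMarkovKernel (Q s)] (x : E) (hf : Integrable f (Q s x))
    (ha : Integrable (opApply A f) (Q s x)) : ∫ y, incrFun Q A f s (x, y) ∂(Q s x) = 0 := by
  have h1 : Integrable (fun y => f y - kernelAvg (Q s) f x) (Q s x) := hf.sub (integrable_const _)
  have h1' : Integrable (fun y => -(f y - kernelAvg (Q s) f x)) (Q s x) := h1.neg
  have h2 : Integrable (fun y => opApply A f y - kernelAvg (Q s) (opApply A f) x) (Q s x) :=
    ha.sub (integrable_const _)
  simp only [incrFun]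
  rw [integral_add h1' (h2.const_mul _), integral_neg, integral_const_mul,
    integral_sub hf (integrable_const _), integral_sub ha (integrable_const _)]
  simp [kernelAvg]

end Increments

/-- The bound of the conditional moments, summed and normalized, is negligible. -/
lemma StepWeightGC.tendsto_sum_div {Ω E : Type*} [MeasurableSpace Ω] {μ : Measure Ω} {γ : ℕ → ℝ}
    {X : ℕ → Ω → E} {g : E → ℝ} {ρ : ℝ} {εX εGC : ℝ → ℝ} (hρ : ρ ∈ Set.Icc (1 : ℝ) 2)
    (hγ : IsStepSequence γ) (hεX : IsRate εX) (hw : IsWeight fun n => εX (γ n))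
    (hSW : StepWeightGC μ γ X g ρ εX εGC) :
    ∀ᵐ ω ∂μ, Tendsto (fun n => (∑ k ∈ Finset.range n, εGC (γ (k + 1)) * g (X k ω))
      / cumWeight (fun k => εX (γ k)) n ^ (ρ / 2)) atTop (𝓝 0) := by
  have hρ0 : 0 < ρ / 2 := by linarith [hρ.1]
  filter_upwards [hSW] with ω hω
  refine tendsto_sum_div_of_tendsto_sum_div
    (b := fun n => cumWeight (fun k => εX (γ k)) n ^ (ρ / 2)) 
    (c := ∑' n, εGC (γ (n + 1)) / cumWeight (fun k => εX (γ k)) (n + 1) ^ (ρ / 2) * g (X n ω))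
    ?_ ?_ ?_ ?_
  · exact fun m n hmn => Real.rpow_le_rpow (hw.cumWeight_nonneg m) (hw.cumWeight_monotone hmn) hρ0.le
  · exact fun n => Real.rpow_pos_of_pos (cumWeight_rate_pos hεX hγ hw n) _
  · exact (tendsto_rpow_atTop hρ0).comp hw.tendsto_cumWeight
  · refine hω.hasSum.tendsto_sum_nat.congr fun n => Finset.sum_congr rfl fun k _ => ?_
    ring

/-! ### Centering, conditional moments and almost sure negligibility of the increments -/

section Chain

variable {E : Type*} [MeasurableSpace E] {Ω : Type*} [MeasurableSpace Ω] {μ : Measure Ω}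
  {Q : ℝ → Kernel E E} {γ : ℕ → ℝ} {X : ℕ → Ω → E}
  {A : (E → ℝ) →ₗ.[ℝ] (E → ℝ)} {f g : E → ℝ}

lemma IsSchemeChain.measurable_martIncr (hX : IsSchemeChain μ Q γ X) (hf : Measurable f)
    (ha : Measurable (opApply A f)) (k : ℕ) :
    Measurable[hX.pastFiltration (k + 1)] (martIncr Q γ X A f k) :=
  (measurable_incrFun hf ha (γ (k + 1))).comp
    ((measurable_pastSigma X k.le_succ).prodMk (measurable_pastSigma X le_rfl))

lemma IsSchemeChain.measurable_martIncr' (hX : IsSchemeChain μ Q γ X) (hf : Measurable f)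
    (ha : Measurable (opApply A f)) (k : ℕ) : Measurable (martIncr Q γ X A f k) :=
  (hX.measurable_martIncr hf ha k).mono (hX.pastFiltration.le _) le_rfl

variable [IsProbabilityMeasure μ]

/-- Integrability is required on `S` only: the joint law restricted to `S` disintegrates through
`Q`, and the inner integral is zero for every starting point. -/
lemma IsSchemeChain.setIntegral_martIncr (hX : IsSchemeChain μ Q γ X) (hf : Measurable f)
    (ha : Measurable (opApply A f)) (k : ℕ) [IsMarkovKernel (Q (γ (k + 1)))]
    (hfi : ∀ x, Integrable f (Q (γ (k + 1)) x))
    (hai : ∀ x, Integrable (opApply A f) (Q (γ (k + 1)) x))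
    {S : Set Ω} (hS : MeasurableSet[pastSigma X k] S)
    (hi : IntegrableOn (martIncr Q γ X A f k) S μ) : ∫ ω in S, martIncr Q γ X A f k ω ∂μ = 0 := by
  have h := hX.setIntegral_eq k hS (measurable_incrFun hf ha (γ (k + 1))).stronglyMeasurable hi
  simp only [integral_incrFun _ _ (hfi _) (hai _), integral_zero] at h
  exact h

/-- The conditional `ρ`-th moment of an increment given the past only depends on the present. -/
lemma IsSchemeChain.condLExp_martIncr_past (hX : IsSchemeChain μ Q γ X) (hf : Measurable f)
    (ha : Measurable (opApply A f)) (k : ℕ) [IsMarkovKernel (Q (γ (k + 1)))] (ρ : ℝ) :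
    μ⁻[fun ω => ENNReal.ofReal (|martIncr Q γ X A f k ω| ^ ρ) | pastSigma X k]
      =ᵐ[μ] μ⁻[fun ω => ENNReal.ofReal (|martIncr Q γ X A f k ω| ^ ρ) | presentSigma X k] := by
  have hm := measurable_incrFun (Q := Q) hf ha (γ (k + 1))
  have hh : Measurable fun p : E × E =>
      ENNReal.ofReal (|incrFun Q A f (γ (k + 1)) p| ^ ρ) := by fun_prop
  have hφ : Measurable fun x => ∫⁻ y, ENNReal.ofReal (|incrFun Q A f (γ (k + 1)) (x, y)| ^ ρ)
      ∂(Q (γ (k + 1)) x) := Measurable.lintegral_kernel_prod_right' hh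
  have hle : presentSigma X k ≤ pastSigma X k := comap_le_pastSigma X le_rfl
  have e1 := ae_eq_condLExp (hX.pastSigma_le k) μ
    (fun ω => ENNReal.ofReal (|martIncr Q γ X A f k ω| ^ ρ))
    (hφ.comp (measurable_pastSigma X le_rfl)) fun S hS => (hX.setLIntegral_eq k hS hh).symm
  have e2 := ae_eq_condLExp (hX.presentSigma_le k) μ
    (fun ω => ENNReal.ofReal (|martIncr Q γ X A f k ω| ^ ρ))
    (hφ.comp (comap_measurable (X k))) fun S hS => (hX.setLIntegral_eq k (hle _ hS) hh).symm
  exact e1.symm.trans e2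

/-- Increments whose `ρ`-th moments are controlled: their normalized sum vanishes almost surely. -/
lemma IsSchemeChain.ae_tendsto_sum_martIncr_div (hX : IsSchemeChain μ Q γ X)
    (hQ : ∀ s, 0 < s → IsMarkovKernel (Q s)) (hγ : IsStepSequence γ) (hf : Measurable f)
    (ha : Measurable (opApply A f))
    (hfi : ∀ k x, Integrable f (Q (γ (k + 1)) x))
    (hai : ∀ k x, Integrable (opApply A f) (Q (γ (k + 1)) x))
    {ρ C : ℝ} {εX εGC : ℝ → ℝ} (hρ : ρ ∈ Set.Icc (1 : ℝ) 2) (hεX : IsRate εX) (hεGC : IsRate εGC)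
    (hw : IsWeight fun n => εX (γ n)) (hg : Measurable g) (hg0 : ∀ x, 0 ≤ g x)
    (hSW : StepWeightGC μ γ X g ρ εX εGC) (hC : 0 < C)
    (hb : ∀ k, μ⁻[fun ω => ENNReal.ofReal (|martIncr Q γ X A f k ω| ^ ρ) | presentSigma X k]
      ≤ᵐ[μ] fun ω => ENNReal.ofReal (C * εGC (γ (k + 1)) * g (X k ω))) :
    ∀ᵐ ω ∂μ, Tendsto (fun n => (∑ k ∈ Finset.range n, martIncr Q γ X A f k ω)
      / √(cumWeight (fun k => εX (γ k)) n)) atTop (𝓝 0) := by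
  set H := cumWeight (fun k => εX (γ k)) with hH
  have hHpos : ∀ n, 0 < H (n + 1) := cumWeight_rate_pos hεX hγ hw
  have hMk : ∀ k, IsMarkovKernel (Q (γ (k + 1))) := fun k => hQ _ (hγ.pos _ (by omega))
  have hε0 : ∀ k, 0 ≤ εGC (γ (k + 1)) := fun k => hεGC.nonneg _ (hγ.pos _ (by omega)).le
  have hpow : ∀ k, √(H (k + 1)) ^ ρ = H (k + 1) ^ (ρ / 2) := fun k => by
    rw [Real.sqrt_eq_rpow, ← Real.rpow_mul (hHpos k).le]; congr 1; ring
  -- Dividing the increment by `√H (k + 1)` turns the bound of its conditional `ρ`-th moment into a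
  -- multiple of the general term of the step-weight series. Kronecker's lemma afterwards undoes the
  -- division.
  have hconv := ae_exists_tendsto_sum_of_summable (μ := μ) (ℱ := hX.pastFiltration) hρ
    (D := fun k ω => martIncr Q γ X A f k ω / √(H (k + 1)))
    (v := fun k ω => C * (εGC (γ (k + 1)) / H (k + 1) ^ (ρ / 2) * g (X k ω)))
    (fun k => ((hX.measurable_martIncr hf ha k).div_const _).stronglyMeasurable)
    (fun k S hS hi => by
      have := hMk k
      rw [integral_div, hX.setIntegral_martIncr hf ha k (hfi k) (hai k) hS, zero_div]
      have h2 := hi.mul_const (√(H (k + 1)))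
      refine h2.congr (ae_of_all _ fun ω => ?_)
      exact div_mul_cancel₀ _ (Real.sqrt_pos.2 (hHpos k)).ne')
    (fun k => ((hg.comp (measurable_pastSigma X le_rfl)).const_mul _).const_mul _)
    (fun k ω => mul_nonneg hC.le (mul_nonneg (div_nonneg (hε0 k)
      (Real.rpow_nonneg (hHpos k).le _)) (hg0 _)))
    (fun k => by
      have := hMk k
      have hc0 : 0 < H (k + 1) ^ (ρ / 2) := Real.rpow_pos_of_pos (hHpos k) _
      have e1 : (fun ω => ENNReal.ofReal (|martIncr Q γ X A f k ω / √(H (k + 1))| ^ ρ))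
          = ENNReal.ofReal (H (k + 1) ^ (ρ / 2))⁻¹ •
            fun ω => ENNReal.ofReal (|martIncr Q γ X A f k ω| ^ ρ) := by
        ext ω
        rw [Pi.smul_apply, smul_eq_mul, ← ENNReal.ofReal_mul (inv_nonneg.2 hc0.le), abs_div,
          abs_of_nonneg (Real.sqrt_nonneg _), Real.div_rpow (abs_nonneg _) (Real.sqrt_nonneg _),
          hpow k, div_eq_inv_mul]
      rw [e1]
      filter_upwards [condLExp_smul' (P := μ) (mΩ := pastSigma X k)
        (fun ω => ENNReal.ofReal (|martIncr Q γ X A f k ω| ^ ρ))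
        (c := ENNReal.ofReal (H (k + 1) ^ (ρ / 2))⁻¹) ENNReal.ofReal_ne_top,
        hX.condLExp_martIncr_past hf ha k ρ, hb k] with ω h1 h2 h3
      refine (le_of_eq h1).trans ?_
      rw [Pi.smul_apply, smul_eq_mul, h2]
      refine (mul_le_mul_right h3 _).trans (le_of_eq ?_)
      rw [← ENNReal.ofReal_mul (inv_nonneg.2 hc0.le)]
      congr 1
      field_simp)
    (hSW.mono fun ω hω => hω.mul_left C)
  filter_upwards [hconv] with ω ⟨c, hc⟩
  exact tendsto_sum_div_of_tendsto_sum_div (b := fun n => √(H n))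
    (fun m n hmn => Real.sqrt_le_sqrt (hw.cumWeight_monotone hmn))
    (fun n => Real.sqrt_pos.2 (hHpos n)) (Real.tendsto_sqrt_atTop.comp hw.tendsto_cumWeight) hc

end Chain

/-! ### The central limit theorem for the increments -/

section ChainCLT

variable {E : Type*} [MeasurableSpace E] {Ω : Type*} [MeasurableSpace Ω] {μ : Measure Ω}
  [IsProbabilityMeasure μ] {Q : ℝ → Kernel E E} {γ : ℕ → ℝ} {X : ℕ → Ω → E}
  {A : (E → ℝ) →ₗ.[ℝ] (E → ℝ)} {f g Vf : E → ℝ}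

/-- No sign is assumed for `Vf`, but along the chain `εX * Vf` is a.s. a conditional second moment,
so the empirical means are nonnegative and so is their limit. -/
lemma nonneg_of_tendsto_empMean {ρ v : ℝ} {εX εGC : ℝ → ℝ}
    (hw : IsWeight fun n => εX (γ n)) {χ : ℕ → Ω → ℝ}
    (hχ : IsIncrApprox μ Q γ X A f g ρ εX εGC Vf χ)
    (hV : ∀ᵐ ω ∂μ, Tendsto (fun n => empMean (fun n => εX (γ n)) (fun k => X k ω) n Vf) atTop
      (𝓝 v)) : 0 ≤ v := by
  have hpos : ∀ᵐ ω ∂μ, ∀ k, 0 ≤ εX (γ (k + 1)) * Vf (X k ω) := by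
    refine ae_all_iff.2 fun k => ?_
    filter_upwards [hχ.variance k, condExp_nonneg (m := presentSigma X k) (μ := μ)
      (ae_of_all _ fun ω => sq_nonneg (χ (k + 1) ω))] with ω h1 h2
    rw [← h1]; exact h2
  obtain ⟨ω, h1, h2⟩ := (hpos.and hV).exists
  refine ge_of_tendsto' h2 fun n => ?_
  rw [empMean_eq_sum_range]
  exact mul_nonneg (inv_nonneg.2 (hw.cumWeight_nonneg n)) (Finset.sum_nonneg fun k _ => h1 k)

/-- The conditional characteristic functions of the increments are close to Gaussian ones. -/
lemma IsSchemeChain.tendstoInMeasure_sum_norm_condExp_sub (hX : IsSchemeChain μ Q γ X)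
    (hQ : ∀ s, 0 < s → IsMarkovKernel (Q s)) (hγ : IsStepSequence γ) (hf : Measurable f)
    (ha : Measurable (opApply A f))
    (hfi : ∀ k x, Integrable f (Q (γ (k + 1)) x))
    (hai : ∀ k x, Integrable (opApply A f) (Q (γ (k + 1)) x))
    {ρ v : ℝ} {εX εGC : ℝ → ℝ} (hρ : ρ ∈ Set.Icc (1 : ℝ) 2) (hεX : IsRate εX) (hεGC : IsRate εGC)
    (hw : IsWeight fun n => εX (γ n)) (hg : Measurable g) (hg0 : ∀ x, 0 ≤ g x)
    (hSW : StepWeightGC μ γ X g ρ εX εGC) {χ : ℕ → Ω → ℝ}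
    (hχ : IsIncrApprox μ Q γ X A f g ρ εX εGC Vf χ) (hv0 : 0 ≤ v) {t : ℝ} (ht : t ≠ 0)
    {s : ℕ → ℕ → Ω → ℝ} (hs0 : ∀ n k ω, 0 ≤ s n k ω)
    (hs : ∀ n k, (fun ω => (t / √(cumWeight (fun k => εX (γ k)) n)) ^ 2 *
      (μ[fun ω => χ (k + 1) ω ^ 2 | presentSigma X k]) ω) =ᵐ[μ] s n k)
    (hsv : TendstoInMeasure μ (fun n ω => ∑ k ∈ Finset.range n, s n k ω) atTop
      fun _ => t ^ 2 * v) :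
    TendstoInMeasure μ (fun n ω => ∑ k ∈ Finset.range n,
      ‖(μ[fun ω => Complex.exp (Complex.I * (t / √(cumWeight (fun k => εX (γ k)) n) *
          martIncr Q γ X A f k ω : ℝ)) | pastSigma X k]) ω - Complex.exp (-(s n k ω : ℂ) / 2)‖)
      atTop fun _ => 0 := by
  set H := cumWeight (fun k => εX (γ k)) with hH
  have hHpos : ∀ n, 0 < H (n + 1) := cumWeight_rate_pos hεX hγ hw
  have hMk : ∀ k, IsMarkovKernel (Q (γ (k + 1))) := fun k => hQ _ (hγ.pos _ (by omega))
  have hε0 : ∀ k, 0 ≤ εGC (γ (k + 1)) := fun k => hεGC.nonneg _ (hγ.pos _ (by omega)).le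
  have hMm := fun k => hX.measurable_martIncr' hf ha k
  obtain ⟨C, hC, happ⟩ := hχ.approx
  have hle : ∀ k, presentSigma X k ≤ pastSigma X k := fun k => comap_le_pastSigma X le_rfl
  -- The hypotheses on `χ` are conditional on the present state, and `χ` need not be a function of
  -- the chain. The increment is one, so its conditional characteristic function can be computed in
  -- the smaller `σ`-algebra.
  have hcond : ∀ n k, μ[fun ω => Complex.exp (Complex.I * (t / √(H n) *
        martIncr Q γ X A f k ω : ℝ)) | pastSigma X k]
      =ᵐ[μ] μ[fun ω => Complex.exp (Complex.I * (t / √(H n) *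
        martIncr Q γ X A f k ω : ℝ)) | presentSigma X k] := by
    intro n k
    have := hMk k
    have hm := measurable_incrFun (Q := Q) hf ha (γ (k + 1))
    have hh : StronglyMeasurable fun p : E × E => Complex.exp (Complex.I * (t / √(H n) *
        incrFun Q A f (γ (k + 1)) p : ℝ)) := Measurable.stronglyMeasurable (by fun_prop)
    have hi : Integrable (fun ω => Complex.exp (Complex.I * (t / √(H n) *
        incrFun Q A f (γ (k + 1)) (X k ω, X (k + 1) ω) : ℝ))) μ := by
      have h1 := hX.measurable k
      have h2 := hX.measurable (k + 1)
      exact Integrable.of_bound (C := 1) (Measurable.aestronglyMeasurable (by fun_prop))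
        (ae_of_all _ fun ω => by rw [mul_comm, Complex.norm_exp_ofReal_mul_I])
    exact (hX.condExp_eq k (hle k) le_rfl hh hi).trans (hX.condExp_eq k le_rfl (hle k) hh hi).symm
  have hgsum := tendstoInMeasure_of_tendsto_ae (f := fun n ω => (∑ k ∈ Finset.range n,
      εGC (γ (k + 1)) * g (X k ω)) / H n ^ (ρ / 2)) (g := fun _ => (0 : ℝ)) (μ := μ)
    (fun n => by
      have hXm := hX.measurable
      exact Measurable.aestronglyMeasurable (by fun_prop))
    (hSW.tendsto_sum_div hρ hγ hεX hw)
  refine tendstoInMeasure_zero_of_forall_bound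
    (fun n ω => Finset.sum_nonneg fun _ _ => norm_nonneg _) fun δ hδ => ?_
  have htv : 0 ≤ t ^ 2 * v := mul_nonneg (sq_nonneg _) hv0
  -- The left side of the last inequality is the limit of the dominating sequence: its perturbation
  -- term and its Lindeberg term tend to zero.
  obtain ⟨ε, hε, hε1, hεδ⟩ : ∃ ε : ℝ, 0 < ε ∧ ε < 1 ∧ (2 * ε + ε ^ 2) * (t ^ 2 * v) < δ := by
    refine ⟨min (1 / 2) (δ / (6 * (t ^ 2 * v + 1))), by positivity,
      (min_le_left _ _).trans_lt (by norm_num), ?_⟩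
    set ε := min (1 / 2) (δ / (6 * (t ^ 2 * v + 1)))
    have h0 : 0 < ε := by positivity
    have h1 : ε ≤ 1 / 2 := min_le_left _ _
    have h2 : ε * (6 * (t ^ 2 * v + 1)) ≤ δ := by
      rw [← le_div_iff₀ (by positivity)]; exact min_le_right _ _
    nlinarith [mul_nonneg h0.le htv, mul_nonneg (mul_nonneg h0.le htv) (sub_nonneg.2 h1)]
  -- The truncation `|t χ / √H| > ε` of the one-step estimate is the Lindeberg truncation at level
  -- `√H` times `ε / |t|`; this is where `t ≠ 0` enters.
  have hlind := hχ.lindeberg (ε / |t|) (by positivity)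
  set Lb : ℕ → Ω → ℝ := fun n ω => (H n)⁻¹ * ∑ k ∈ Finset.range n,
      (μ[{ω' | √(H n) * (ε / |t|) < |χ (k + 1) ω'|}.indicator
        (fun ω' => χ (k + 1) ω' ^ 2) | presentSigma X k]) ω with hLb
  refine ⟨fun n ω => (5 + 1 / (4 * ε)) * (|t| ^ ρ * C) *
      ((∑ k ∈ Finset.range n, εGC (γ (k + 1)) * g (X k ω)) / H n ^ (ρ / 2))
      + (2 * ε + ε ^ 2) * (∑ k ∈ Finset.range n, s n k ω)
      + (4 + ∑ k ∈ Finset.range n, s n k ω) * (t ^ 2 * Lb n ω), _, hεδ, ?_, ?_⟩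
  · have hc : ∀ c : ℝ, TendstoInMeasure μ (fun (_ : ℕ) (_ : Ω) => c) atTop fun _ => c := fun c =>
      tendstoInMeasure_of_tendsto tendsto_const_nhds
    have := tendstoInMeasure_add (tendstoInMeasure_add
      (tendstoInMeasure_mul (hc ((5 + 1 / (4 * ε)) * (|t| ^ ρ * C))) hgsum)
      (tendstoInMeasure_mul (hc (2 * ε + ε ^ 2)) hsv))
      (tendstoInMeasure_mul (tendstoInMeasure_add (hc 4) hsv)
        (tendstoInMeasure_mul (hc (t ^ 2)) hlind))
    simpa using this
  · filter_upwards [eventually_ge_atTop 1] with n hn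
    obtain ⟨n', rfl⟩ : ∃ n', n = n' + 1 := ⟨n - 1, by omega⟩
    have hHn := hHpos n'
    generalize n' + 1 = n at hHn
    have hsq : 0 < √(H n) := Real.sqrt_pos.2 hHn
    have hu2 : (t / √(H n)) ^ 2 = t ^ 2 * (H n)⁻¹ := by
      rw [div_pow, Real.sq_sqrt hHn.le, div_eq_mul_inv]
    have huρ : |t / √(H n)| ^ ρ = |t| ^ ρ / H n ^ (ρ / 2) := by
      rw [abs_div, abs_of_pos hsq, Real.div_rpow (abs_nonneg _) hsq.le, Real.sqrt_eq_rpow,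
        ← Real.rpow_mul hHn.le]
      congr 2; ring
    have hset : ∀ k, {ω | ε < |t / √(H n) * χ (k + 1) ω|}
        = {ω' | √(H n) * (ε / |t|) < |χ (k + 1) ω'|} := fun k => by
      ext ω
      have ht' : 0 < |t| := abs_pos.2 ht
      change ε < |t / √(H n) * χ (k + 1) ω| ↔ √(H n) * (ε / |t|) < |χ (k + 1) ω|
      rw [abs_mul, abs_div, abs_of_pos hsq, div_mul_eq_mul_div, lt_div_iff₀ hsq,
        mul_div_assoc', div_lt_iff₀ ht', mul_comm ε, mul_comm |t|]
    have hL0 : ∀ k, 0 ≤ᵐ[μ] μ[{ω' | √(H n) * (ε / |t|) < |χ (k + 1) ω'|}.indicator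
        (fun ω' => χ (k + 1) ω' ^ 2) | presentSigma X k] := fun k =>
      condExp_nonneg (ae_of_all _ fun ω => Set.indicator_nonneg (fun _ _ => sq_nonneg _) _)
    have hone : ∀ k, _ := fun k => by
      have := hMk k
      exact norm_condExp_exp_sub_le (μ := μ) (hX.presentSigma_le k) hρ hε hε1 (t / √(H n))
        (hMm k).aestronglyMeasurable
        (fun S hS hi => hX.setIntegral_martIncr hf ha k (hfi k) (hai k) (hle k _ hS) hi)
        (hχ.memLp k) ((hg.comp (comap_measurable (X k))).const_mul (C * εGC (γ (k + 1))))
        (fun ω => mul_nonneg (mul_nonneg hC.le (hε0 k)) (hg0 _)) (happ k)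
    filter_upwards [ae_all_iff.2 hone, ae_all_iff.2 (hs n), ae_all_iff.2 (hcond n),
      ae_all_iff.2 hL0] with ω h1 h2 h3 h4
    have hterm : ∀ k ∈ Finset.range n, ‖(μ[fun ω => Complex.exp (Complex.I * (t / √(H n) *
          martIncr Q γ X A f k ω : ℝ)) | pastSigma X k]) ω - Complex.exp (-(s n k ω : ℂ) / 2)‖
        ≤ (5 + 1 / (4 * ε)) * (|t| ^ ρ * C) * (εGC (γ (k + 1)) * g (X k ω) / H n ^ (ρ / 2))
          + (2 * ε + ε ^ 2) * s n k ω
          + (4 + ∑ k ∈ Finset.range n, s n k ω) * (t ^ 2 * ((H n)⁻¹ *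
            (μ[{ω' | √(H n) * (ε / |t|) < |χ (k + 1) ω'|}.indicator
              (fun ω' => χ (k + 1) ω' ^ 2) | presentSigma X k]) ω)) := by
      intro k hk
      have e1 := h1 k
      have e2 := h2 k
      simp only [hset] at e1
      rw [← h3 k] at e1
      rw [e2, huρ, hu2, Function.comp_apply] at e1
      refine e1.trans ?_
      have e4 : s n k ω ≤ ∑ k ∈ Finset.range n, s n k ω :=
        Finset.single_le_sum (f := fun k => s n k ω) (fun j _ => hs0 n j ω) hk
      have e5 : 0 ≤ t ^ 2 * (H n)⁻¹ * (μ[{ω' | √(H n) * (ε / |t|) < |χ (k + 1) ω'|}.indicator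
              (fun ω' => χ (k + 1) ω' ^ 2) | presentSigma X k]) ω :=
        mul_nonneg (by positivity) (h4 k)
      have e6 := mul_le_mul_of_nonneg_right e4 e5
      have e7 : (5 + 1 / (4 * ε)) * (|t| ^ ρ / H n ^ (ρ / 2) * (C * εGC (γ (k + 1)) * g (X k ω)))
          = (5 + 1 / (4 * ε)) * (|t| ^ ρ * C) * (εGC (γ (k + 1)) * g (X k ω) / H n ^ (ρ / 2)) := by
        ring
      rw [e7]
      linarith
    refine (Finset.sum_le_sum hterm).trans (le_of_eq ?_)
    simp only [hLb, Finset.sum_add_distrib, ← Finset.mul_sum, ← Finset.sum_div]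

/-- Central limit theorem for the normalized sums of the increments. -/
theorem IsSchemeChain.tendstoInDistribution_sum_martIncr (hX : IsSchemeChain μ Q γ X)
    (hQ : ∀ s, 0 < s → IsMarkovKernel (Q s)) (hγ : IsStepSequence γ) (hf : Measurable f)
    (ha : Measurable (opApply A f))
    (hfi : ∀ k x, Integrable f (Q (γ (k + 1)) x))
    (hai : ∀ k x, Integrable (opApply A f) (Q (γ (k + 1)) x))
    {ρ v : ℝ} {εX εGC : ℝ → ℝ} (hρ : ρ ∈ Set.Icc (1 : ℝ) 2) (hεX : IsRate εX) (hεGC : IsRate εGC)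
    (hw : IsWeight fun n => εX (γ n)) (hg : Measurable g) (hg0 : ∀ x, 0 ≤ g x)
    (hSW : StepWeightGC μ γ X g ρ εX εGC) {χ : ℕ → Ω → ℝ}
    (hχ : IsIncrApprox μ Q γ X A f g ρ εX εGC Vf χ) (hVm : Measurable Vf)
    (hV : ∀ᵐ ω ∂μ, Tendsto (fun n => empMean (fun n => εX (γ n)) (fun k => X k ω) n Vf) atTop
      (𝓝 v)) :
    TendstoInDistribution (fun (n : ℕ) ω => (∑ k ∈ Finset.range n, martIncr Q γ X A f k ω)
      / √(cumWeight (fun k => εX (γ k)) n)) atTop (id : ℝ → ℝ) (fun _ => μ)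
      (gaussianReal 0 v.toNNReal) := by
  have hv0 : 0 ≤ v := nonneg_of_tendsto_empMean hw hχ hV
  set H := cumWeight (fun k => εX (γ k)) with hH
  have hMm := fun k => hX.measurable_martIncr' hf ha k
  have hZm : ∀ n, Measurable fun ω => (∑ k ∈ Finset.range n, martIncr Q γ X A f k ω) / √(H n) :=
    fun n => (Finset.measurable_sum _ fun k _ => hMm k).div_const _
  refine ⟨fun n => (hZm n).aemeasurable, aemeasurable_id, ?_⟩
  refine ProbabilityMeasure.tendsto_iff_tendsto_charFun.2 fun t => ?_
  change Tendsto (fun n => charFun (μ.map fun ω =>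
    (∑ k ∈ Finset.range n, martIncr Q γ X A f k ω) / √(H n)) t) atTop
    (𝓝 (charFun ((gaussianReal 0 v.toNNReal).map id) t))
  rw [Measure.map_id, charFun_gaussianReal]
  rcases eq_or_ne t 0 with rfl | ht
  · have := fun n => Measure.isProbabilityMeasure_map (μ := μ) (hZm n).aemeasurable
    simp
  simp only [charFun_apply_real]
  -- The positive part yields a version of the scaled conditional variance that is nonnegative
  -- everywhere, as the cut-off argument demands; it changes values on a null set only.
  set s : ℕ → ℕ → Ω → ℝ := fun n k ω =>
    (t / √(H n)) ^ 2 * max 0 (εX (γ (k + 1)) * Vf (X k ω)) with hs_def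
  have hs0 : ∀ n k ω, 0 ≤ s n k ω := fun n k ω => mul_nonneg (sq_nonneg _) (le_max_left _ _)
  have hpos : ∀ᵐ ω ∂μ, ∀ k, 0 ≤ εX (γ (k + 1)) * Vf (X k ω) := by
    refine ae_all_iff.2 fun k => ?_
    filter_upwards [hχ.variance k, condExp_nonneg (m := presentSigma X k) (μ := μ)
      (ae_of_all _ fun ω => sq_nonneg (χ (k + 1) ω))] with ω h1 h2
    rw [← h1]; exact h2
  have hsm : ∀ n k, Measurable[hX.pastFiltration k] (s n k) := fun n k =>
    (measurable_const.max ((hVm.comp (measurable_pastSigma X le_rfl)).const_mul _)).const_mul _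
  have hs : ∀ n k, (fun ω => (t / √(H n)) ^ 2 *
      (μ[fun ω => χ (k + 1) ω ^ 2 | presentSigma X k]) ω) =ᵐ[μ] s n k := fun n k => by
    filter_upwards [hχ.variance k, hpos] with ω h1 h2
    rw [h1, hs_def]
    simp only [max_eq_right (h2 k)]
  have hsv : TendstoInMeasure μ (fun n ω => ∑ k ∈ Finset.range n, s n k ω) atTop
      fun _ => t ^ 2 * v := by
    refine tendstoInMeasure_of_tendsto_ae (fun n => (Finset.measurable_sum _ fun k _ =>
      (hsm n k).mono (hX.pastFiltration.le k) le_rfl).aestronglyMeasurable) ?_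
    filter_upwards [hV, hpos] with ω h1 h2
    refine (h1.const_mul (t ^ 2)).congr fun n => ?_
    rw [empMean_eq_sum_range, ← mul_assoc, Finset.mul_sum]
    refine Finset.sum_congr rfl fun k _ => ?_
    simp only [hs_def, max_eq_right (h2 k)]
    rw [div_pow, Real.sq_sqrt (hw.cumWeight_nonneg n), div_eq_mul_inv]
  have key := tendsto_integral_exp_sum (μ := μ) (ℱ := hX.pastFiltration)
    (Y := fun n k ω => t / √(H n) * martIncr Q γ X A f k ω) (s := s)
    (fun n k => (hX.measurable_martIncr hf ha k).const_mul _) hsm hs0 hsv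
    (hX.tendstoInMeasure_sum_norm_condExp_sub hQ hγ hf ha hfi hai hρ hεX hεGC hw hg hg0 hSW hχ hv0
      ht hs0 hs hsv)
  have hlim : Complex.exp (-((t ^ 2 * v : ℝ) : ℂ) / 2)
      = Complex.exp (t * (0 : ℝ) * Complex.I - (v.toNNReal : ℝ) * t ^ 2 / 2) := by
    rw [Real.coe_toNNReal v hv0]
    congr 1; push_cast; ring
  rw [hlim] at key
  refine key.congr fun n => ?_
  rw [integral_map (hZm n).aemeasurable (Measurable.aestronglyMeasurable (by fun_prop))]
  refine integral_congr_ae (ae_of_all _ fun ω => ?_)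
  simp only
  congr 1
  rw [← Finset.mul_sum]
  push_cast
  ring

end ChainCLT

/-! ### Slutsky-type statements -/

section Slutsky

variable {Ω Ω' : Type*} [MeasurableSpace Ω] [MeasurableSpace Ω'] {μ : Measure Ω} {μ' : Measure Ω'}
  [IsProbabilityMeasure μ] [IsProbabilityMeasure μ']

/-- A sequence that converges in distribution, multiplied by constants that vanish. -/
lemma tendstoInMeasure_mul_of_tendstoInDistribution {Z : ℕ → Ω → ℝ} {W : Ω' → ℝ} {c : ℕ → ℝ}
    (hZ : TendstoInDistribution Z atTop W (fun _ => μ) μ') (hc : Tendsto c atTop (𝓝 0)) :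
    TendstoInMeasure μ (fun n ω => Z n ω * c n) atTop fun _ => 0 := by
  have h := hZ.continuous_comp_prodMk_of_tendstoInMeasure_const (Y := fun n _ => c n) (c := (0 : ℝ))
    (g := fun p : ℝ × ℝ => p.1 * p.2) (by fun_prop) (tendstoInMeasure_of_tendsto hc)
    (fun _ => aemeasurable_const)
  rw [tendstoInMeasure_iff_dist]
  intro ε hε
  -- The products converge in law to the constant zero; the portmanteau inequality for this closed
  -- set, which zero avoids, gives convergence in probability.
  have hF : IsClosed {x : ℝ | ε ≤ dist x 0} := isClosed_le continuous_const (by fun_prop)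
  have hlim := ProbabilityMeasure.limsup_measure_closed_le_of_tendsto h.tendsto hF
  simp only [ProbabilityMeasure.coe_mk] at hlim
  rw [Measure.map_apply_of_aemeasurable h.aemeasurable_limit hF.measurableSet] at hlim
  have hempty : (fun ω => W ω * (0 : ℝ)) ⁻¹' {x : ℝ | ε ≤ dist x 0} = ∅ := by
    ext ω
    change ε ≤ dist (W ω * 0) 0 ↔ False
    simp [hε]
  rw [hempty, measure_empty] at hlim
  have hmap : ∀ n, (μ.map fun ω => Z n ω * c n) {x : ℝ | ε ≤ dist x 0}
      = μ {ω | ε ≤ dist (Z n ω * c n) 0} := fun n =>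
    Measure.map_apply_of_aemeasurable (h.forall_aemeasurable n) hF.measurableSet
  simp only [hmap] at hlim
  exact tendsto_of_le_liminf_of_limsup_le zero_le hlim

/-- Slutsky's theorem with a centered Gaussian limit. -/
lemma tendstoInDistribution_gaussian_add {Z R : ℕ → Ω → ℝ} {v : ℝ≥0} {r : ℝ}
    (hZ : TendstoInDistribution Z atTop (id : ℝ → ℝ) (fun _ => μ) (gaussianReal 0 v))
    (hR : TendstoInMeasure μ R atTop fun _ => r) (hRm : ∀ n, AEMeasurable (R n) μ) :
    TendstoInDistribution (fun n ω => Z n ω + R n ω) atTop (id : ℝ → ℝ) (fun _ => μ)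
      (gaussianReal r v) := by
  have h := hZ.add_of_tendstoInMeasure_const hR hRm
  refine ⟨h.forall_aemeasurable, aemeasurable_id, ?_⟩
  have e : (gaussianReal 0 v).map (fun ω => id ω + r) = (gaussianReal r v).map id := by
    rw [Measure.map_id]
    simpa using gaussianReal_map_add_const (μ := 0) (v := v) r
  have e' : (⟨(gaussianReal 0 v).map (fun ω => id ω + r),
      Measure.isProbabilityMeasure_map h.aemeasurable_limit⟩ : ProbabilityMeasure ℝ)
      = ⟨(gaussianReal r v).map id, Measure.isProbabilityMeasure_map aemeasurable_id⟩ :=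
    Subtype.ext e
  rw [← e']
  exact h.tendsto

end Slutsky

/-! ### The trapezoidal decomposition -/

section Decomposition

variable {E : Type*} [MeasurableSpace E]

/-- The deviation of the scheme from the trapezoidal rule over one step of size `s`. -/
noncomputable def expErr (Q : ℝ → Kernel E E) (A : (E → ℝ) →ₗ.[ℝ] (E → ℝ)) (f : E → ℝ) (s : ℝ)
    (x : E) : ℝ :=
  -(kernelAvg (Q s) f x - f x) +
    s / 2 * (kernelAvg (Q s) (opApply A f) x + opApply A f x)

variable {Q : ℝ → Kernel E E} {A : (E → ℝ) →ₗ.[ℝ] (E → ℝ)} {f : E → ℝ} {γ : ℕ → ℝ}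

/-- The terms `s² / 2 * A²f` of the two remainders cancel, so no regularity or integrability of
`A²f` along the chain is ever needed. -/
lemma rem_eq_expErr {s : ℝ} (hs : s ≠ 0) (x : E) :
    -rem2 Q A f x s + s / 2 * rem1 Q A (opApply A f) x s = expErr Q A f s x := by
  unfold rem1 rem2 pseudoGen expErr
  field_simp
  ring

lemma measurable_expErr (hf : Measurable f) (ha : Measurable (opApply A f)) (s : ℝ) :
    Measurable (expErr Q A f s) := by
  have h1 := measurable_kernelAvg (Q s) hf
  have h2 := measurable_kernelAvg (Q s) ha
  unfold expErr
  fun_prop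

/-- Regrouping the trapezoidal sums by states gives `X k` half of each adjacent step. The convention
`γ 0 = 0` accounts for the first state, and the last one contributes the unmatched half-step `γ n /
2`. -/
lemma sum_midWeight_mul {Ω : Type*} (hγ0 : γ 0 = 0) (X : ℕ → Ω → E) (C : ℝ) (n : ℕ) (ω : Ω) :
    ∑ k ∈ Finset.range n, midWeight C γ (k + 1) * opApply A f (X k ω)
      = C * (f (X n ω) - f (X 0 ω) - γ n / 2 * opApply A f (X n ω)
        + ∑ k ∈ Finset.range n, expErr Q A f (γ (k + 1)) (X k ω)
        + ∑ k ∈ Finset.range n, martIncr Q γ X A f k ω) := by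
  induction n with
  | zero => simp [hγ0]
  | succ n ih =>
    rw [Finset.sum_range_succ, Finset.sum_range_succ, Finset.sum_range_succ, ih]
    simp only [midWeight, expErr, martIncr, Nat.add_sub_cancel]
    ring

lemma midMean_eq {Ω : Type*} (hγ : IsStepSequence γ) (X : ℕ → Ω → E) {C : ℝ} (hC : 0 < C) (c : ℝ)
    (n : ℕ) (ω : Ω) :
    cumWeight (midWeight C γ) n / (C * c)
        * empMean (midWeight C γ) (fun k => X k ω) n (opApply A f)
      = (f (X n ω) - f (X 0 ω) - γ n / 2 * opApply A f (X n ω)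
        + ∑ k ∈ Finset.range n, expErr Q A f (γ (k + 1)) (X k ω)
        + ∑ k ∈ Finset.range n, martIncr Q γ X A f k ω) / c := by
  cases n with
  | zero => simp [cumWeight, hγ.zero]
  | succ n =>
    have hpos : 0 < cumWeight (midWeight C γ) (n + 1) := by
      rw [cumWeight_eq_sum_range]
      refine Finset.sum_pos (fun k _ => ?_) ⟨0, by simp⟩
      have h1 := hγ.pos (k + 1) (by omega)
      have h2 : 0 ≤ γ k := by
        rcases Nat.eq_zero_or_pos k with rfl | hk
        · exact hγ.zero.ge
        · exact (hγ.pos k hk).le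
      simp only [midWeight, Nat.add_sub_cancel]
      positivity
    rw [empMean_eq_sum_range, sum_midWeight_mul (Q := Q) hγ.zero X C]
    field_simp

/-- The expansion hypothesis compares each `expErr` with `ηt * 𝔐 f`. The accumulated discrepancy is
a finite sum of the error means above, and the empirical means of `𝔐 f` converge by assumption. -/
lemma WeakExpansion2.ae_tendsto_sum_expErr [TopologicalSpace E] {Ω Ω' : Type*} [MeasurableSpace Ω]
    [MeasurableSpace Ω'] {μ : Measure Ω} {μ' : Measure Ω'} {ν : Measure E} {X : ℕ → Ω → E}
    {F : Set (E → ℝ)} {𝔐 : (E → ℝ) → E → ℝ} {ηt : ℝ → ℝ} (hγ : IsStepSequence γ)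
    (hE : WeakExpansion2 μ μ' ν Q γ X A F 𝔐 ηt) (hf : f ∈ F) :
    ∀ᵐ ω ∂μ, Tendsto (fun n => (∑ k ∈ Finset.range n, expErr Q A f (γ (k + 1)) (X k ω))
      / cumWeight (fun k => ηt (γ k)) n) atTop (𝓝 (∫ x, 𝔐 f x ∂ν)) := by
  obtain ⟨l, g, L, hrep, hbound⟩ := hE.expansion f hf
  have hw := hE.weight
  filter_upwards [hE.tendsto_M f hf, ae_all_iff.2 hrep.g_bounded] with ω h1 h2
  have h3 : Tendsto (fun n => ∑ i, (cumWeight (fun k => ηt (γ k)) n)⁻¹ * ∑ k ∈ Finset.range n,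
      ηt (γ (k + 1)) * (g i (X k ω) * ∫ v, L i (X k ω) (γ (k + 1)) v ∂μ')) atTop (𝓝 0) := by
    have := tendsto_finsetSum Finset.univ fun (i : Fin l) _ =>
      tendsto_weighted_error hw hγ (fun k => X k ω) (hrep.g_nonneg i) (hrep.L_nonneg i)
        (hrep.L_measurable i) (hrep.L_dominated i) (hrep.L_small i) (h2 i)
    simpa using this
  have h4 : Tendsto (fun n => (∑ k ∈ Finset.range n, expErr Q A f (γ (k + 1)) (X k ω))
      / cumWeight (fun k => ηt (γ k)) n
      - empMean (fun n => ηt (γ n)) (fun k => X k ω) n (𝔐 f)) atTop (𝓝 0) := by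
    refine squeeze_zero_norm (fun n => ?_) h3
    have hinv : 0 ≤ (cumWeight (fun k => ηt (γ k)) n)⁻¹ := inv_nonneg.2 (hw.cumWeight_nonneg n)
    rw [empMean_eq_sum_range, div_eq_inv_mul, ← mul_sub, ← Finset.sum_sub_distrib, norm_mul,
      Real.norm_of_nonneg hinv, ← Finset.mul_sum, Finset.sum_comm]
    refine mul_le_mul_of_nonneg_left ((norm_sum_le _ _).trans (Finset.sum_le_sum fun k _ => ?_)) hinv
    have := hbound (X k ω) (γ (k + 1)) (hγ.mem_Ioc k)
    rw [rem_eq_expErr (hγ.pos _ (by omega)).ne', Finset.mul_sum] at this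
    exact this
  simpa using h4.add h1

end Decomposition

end FellerCLT

/-! ### The theorem: combination of the three terms -/

theorem mainTheorem2
    {E : Type*} [MetricSpace E] [LocallyCompactSpace E] [TopologicalSpace.SeparableSpace E]
    [MeasurableSpace E] [BorelSpace E]
    {Ω : Type*} [MeasurableSpace Ω] (μ : Measure Ω) [IsProbabilityMeasure μ]
    {Ω' : Type*} [MeasurableSpace Ω'] (μ' : Measure Ω') [IsProbabilityMeasure μ']
    -- the Feller semigroup, its (extended) generator and an invariant distribution
    (T : FellerSemigroup E) (A : (E → ℝ) →ₗ.[ℝ] (E → ℝ)) (hA : ExtendsGenerator T A)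
    (ν : Measure E) [IsProbabilityMeasure ν] (hν : T.IsInvariant ν)
    -- the approximation scheme
    (Q : ℝ → Kernel E E) (hQ : ∀ s, 0 < s → IsMarkovKernel (Q s))
    (γ : ℕ → ℝ) (hγ : IsStepSequence γ)
    (X : ℕ → Ω → E) (hX : IsSchemeChain μ Q γ X)
    -- the data of the theorem
    (F : Set (E → ℝ)) (hF : IsTestClass A F)
    (g : E → ℝ) (hg : Measurable g) (hg0 : ∀ x, 0 ≤ g x)
    (ρ : ℝ) (hρ : ρ ∈ Set.Icc (1 : ℝ) 2)
    (ηt εX εGC : ℝ → ℝ) (hηt : IsRate ηt) (hεX : IsRate εX) (hεGC : IsRate εGC)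
    (𝔐 𝔙 : (E → ℝ) → E → ℝ) (C : ℝ) (hC : 0 < C)
    -- the assumptions
    (hE : WeakExpansion2 μ μ' ν Q γ X A F 𝔐 ηt)
    (hGC : GrowthControl2 μ ν Q γ X A F g ρ εX εGC 𝔙)
    (hSW : StepWeightGC μ γ X g ρ εX εGC)
    (hbd : ∀ f ∈ F, TendstoInMeasure μ
      (fun (n : ℕ) ω => f (X n ω) / √(cumWeight (fun k => εX (γ k)) n)) atTop
      (fun _ => (0 : ℝ))) :
    ∀ f ∈ F,
      0 ≤ ∫ x, 𝔙 f x ∂ν ∧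
      -- A
      (Tendsto (fun n => √(cumWeight (fun k => εX (γ k)) n) / cumWeight (fun k => ηt (γ k)) n)
          atTop atTop →
        TendstoInDistribution
          (fun (n : ℕ) ω => cumWeight (midWeight C γ) n / (C * √(cumWeight (fun k => εX (γ k)) n))
            * empMean (midWeight C γ) (fun k => X k ω) n (opApply A f))
          atTop (id : ℝ → ℝ) (fun _ => μ)
          (gaussianReal 0 (∫ x, 𝔙 f x ∂ν).toNNReal)) ∧
      -- B
      (∀ lhat : ℝ, 0 < lhat →
        Tendsto (fun n => √(cumWeight (fun k => εX (γ k)) n) / cumWeight (fun k => ηt (γ k)) n)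
          atTop (𝓝 lhat) →
        TendstoInDistribution
          (fun (n : ℕ) ω => cumWeight (midWeight C γ) n / (C * √(cumWeight (fun k => εX (γ k)) n))
            * empMean (midWeight C γ) (fun k => X k ω) n (opApply A f))
          atTop (id : ℝ → ℝ) (fun _ => μ)
          (gaussianReal (lhat⁻¹ * ∫ x, 𝔐 f x ∂ν) (∫ x, 𝔙 f x ∂ν).toNNReal)) ∧
      -- C
      (Tendsto (fun n => √(cumWeight (fun k => εX (γ k)) n) / cumWeight (fun k => ηt (γ k)) n)
          atTop (𝓝 0) →
        TendstoInMeasure μ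
          (fun (n : ℕ) ω => cumWeight (midWeight C γ) n / (C * cumWeight (fun k => ηt (γ k)) n)
            * empMean (midWeight C γ) (fun k => X k ω) n (opApply A f))
          atTop (fun _ => ∫ x, 𝔐 f x ∂ν) ∧
        (𝔙 f = 0 →
          (∀ᵐ ω ∂μ, Tendsto (fun n => f (X n ω) / cumWeight (fun k => ηt (γ k)) n) atTop (𝓝 0)) →
          ∀ᵐ ω ∂μ, Tendsto
            (fun n => cumWeight (midWeight C γ) n / (C * cumWeight (fun k => ηt (γ k)) n)
              * empMean (midWeight C γ) (fun k => X k ω) n (opApply A f))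
            atTop (𝓝 (∫ x, 𝔐 f x ∂ν)))) := by

  intro f hf
  set HX : ℕ → ℝ := cumWeight fun k => εX (γ k) with hHX
  set Hη : ℕ → ℝ := cumWeight fun k => ηt (γ k) with hHη
  set v := ∫ x, 𝔙 f x ∂ν with hv
  set m := ∫ x, 𝔐 f x ∂ν with hm
  have hfm := hF.measurable f hf
  have ham : Measurable (opApply A f) := (hF.continuous_A f hf).measurable
  obtain ⟨B, hB⟩ := hF.bounded_A f hf
  have hMk : ∀ k, IsMarkovKernel (Q (γ (k + 1))) := fun k => hQ _ (hγ.pos _ (by omega))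
  have hfi : ∀ k x, Integrable f (Q (γ (k + 1)) x) := fun k x =>
    hE.integrable_Q f hf _ (hγ.mem_Ioc k) x
  have hai : ∀ k x, Integrable (opApply A f) (Q (γ (k + 1)) x) := fun k x =>
    Integrable.of_bound ham.aestronglyMeasurable B (ae_of_all _ hB)
  have hXm := hX.measurable
  have hw := hGC.weight
  have hXtop : Tendsto (fun n => √(HX n)) atTop atTop :=
    Real.tendsto_sqrt_atTop.comp hw.tendsto_cumWeight
  have hηtop : Tendsto Hη atTop atTop := hE.weight.tendsto_cumWeight
  obtain ⟨χ, hχ⟩ := hGC.exists_approx f hf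
  have hV := hGC.tendsto_V f hf
  have hv0 : 0 ≤ v := nonneg_of_tendsto_empMean hw hχ hV
  have hclt := hX.tendstoInDistribution_sum_martIncr hQ hγ hfm ham hfi hai hρ hεX hεGC hw hg hg0
    hSW hχ (hGC.measurable_V f hf) hV
  have hexp := hE.ae_tendsto_sum_expErr hγ hf
  have hEm : ∀ n, Measurable fun ω => ∑ k ∈ Finset.range n, expErr Q A f (γ (k + 1)) (X k ω) :=
    fun n => Finset.measurable_sum _ fun k _ => (measurable_expErr hfm ham _).comp (hXm k)
  have hterm : ∀ c : ℕ → ℝ, Tendsto c atTop atTop → ∀ ω,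
      Tendsto (fun n => (-f (X 0 ω) - γ n / 2 * opApply A f (X n ω)) / c n) atTop (𝓝 0) := by
    intro c hc ω
    have h1 : Tendsto (fun n => -f (X 0 ω) / c n) atTop (𝓝 0) := hc.const_div_atTop _
    have h2 : Tendsto (fun n => γ n / 2 / c n * opApply A f (X n ω)) atTop (𝓝 0) := by
      have h3 : Tendsto (fun n => γ n / 2 / c n) atTop (𝓝 0) :=
        (hγ.tendsto_zero.div_const 2).div_atTop hc
      refine (bdd_le_mul_tendsto_zero' (f := fun n => opApply A f (X n ω)) B
        (Eventually.of_forall fun n => hB _) h3).congr fun n => ?_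
      exact mul_comm _ _
    have h4 := h1.sub h2
    rw [sub_zero] at h4
    exact h4.congr fun n => by ring
  have hterm' : ∀ c : ℕ → ℝ, Tendsto c atTop atTop → TendstoInMeasure μ
      (fun n ω => (-f (X 0 ω) - γ n / 2 * opApply A f (X n ω)) / c n) atTop fun _ => 0 :=
    fun c hc => tendstoInMeasure_of_tendsto_ae
      (fun n => Measurable.aestronglyMeasurable (by fun_prop)) (ae_of_all _ (hterm c hc))
  -- both central limit theorems at once
  have hAB : ∀ r : ℝ, Tendsto (fun n => Hη n / √(HX n)) atTop (𝓝 r) →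
      TendstoInDistribution
        (fun (n : ℕ) ω => cumWeight (midWeight C γ) n / (C * √(HX n))
          * empMean (midWeight C γ) (fun k => X k ω) n (opApply A f))
        atTop (id : ℝ → ℝ) (fun _ => μ) (gaussianReal (r * m) v.toNNReal) := by
    intro r hr
    have hexp' : TendstoInMeasure μ (fun n ω =>
        (∑ k ∈ Finset.range n, expErr Q A f (γ (k + 1)) (X k ω)) / √(HX n)) atTop
        fun _ => r * m := by
      refine tendstoInMeasure_of_tendsto_ae
        (fun n => ((hEm n).div_const _).aestronglyMeasurable) ?_
      filter_upwards [hexp] with ω hω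
      refine (hr.mul hω).congr' ?_
      filter_upwards [hηtop.eventually_gt_atTop 0] with n hn
      rw [div_mul_div_comm, mul_comm (Hη n), mul_div_mul_right _ _ hn.ne']
    have hR := tendstoInMeasure_add (tendstoInMeasure_add (hbd f hf) (hterm' _ hXtop)) hexp'
    simp only [zero_add] at hR
    have h := tendstoInDistribution_gaussian_add hclt hR fun n => by
      have := hEm n
      exact Measurable.aemeasurable (by fun_prop)
    refine h.congr (fun n => ae_of_all _ fun ω => ?_) (ae_of_all _ fun _ => rfl)
    beta_reduce
    rw [midMean_eq (Q := Q) hγ X hC, ← hHX]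
    ring
  refine ⟨hv0, fun hlim => ?_, fun lhat hl hlim => ?_, fun hlim => ⟨?_, fun hV0 hfb => ?_⟩⟩
  -- The ratio of normalizations is inverted: A is the case `r = 0`, where the drift term is
  -- negligible, and B the case `r = lhat⁻¹`.
  · have h := hAB 0 (hlim.inv_tendsto_atTop.congr fun n => inv_div _ _)
    rwa [zero_mul] at h
  · exact hAB _ ((hlim.inv₀ hl.ne').congr fun n => inv_div _ _)
  -- In regime C the martingale part is the sequence of the central limit theorem times the
  -- vanishing ratio `√HX / Hη`, and the boundary term is treated in the same way.
  · have h1 := tendstoInMeasure_mul_of_tendstoInDistribution hclt hlim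
    have h2 := tendstoInMeasure_mul (hbd f hf) (tendstoInMeasure_of_tendsto (μ := μ) hlim)
    have h3 := tendstoInMeasure_of_tendsto_ae
      (fun n => ((hEm n).div_const (Hη n)).aestronglyMeasurable) hexp
    have h4 := tendstoInMeasure_add (tendstoInMeasure_add (tendstoInMeasure_add h1 h2)
      (hterm' _ hηtop)) h3
    simp only [zero_mul, zero_add] at h4
    refine h4.congr' ?_ (ae_of_all _ fun _ => rfl)
    filter_upwards [hXtop.eventually_gt_atTop 0] with n hn
    refine ae_of_all _ fun ω => ?_
    simp only
    rw [midMean_eq (Q := Q) hγ X hC, div_mul_div_cancel₀ hn.ne', div_mul_div_cancel₀ hn.ne']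
    ring
  -- With `𝔙 f = 0` the variables `χ` have zero second moment, so the growth bound applies to the
  -- increments themselves and gives almost sure control of their sum.
  · have hχ0 : ∀ k, χ (k + 1) =ᵐ[μ] 0 := by
      intro k
      have h1 : ∫ ω, χ (k + 1) ω ^ 2 ∂μ = 0 := by
        rw [← integral_condExp (hX.presentSigma_le k), integral_congr_ae (hχ.variance k)]
        simp [hV0]
      rw [integral_eq_zero_iff_of_nonneg (fun ω => sq_nonneg _) (hχ.memLp k).integrable_sq] at h1
      filter_upwards [h1] with ω hω
      simpa using hω
    obtain ⟨K, hK, happ⟩ := hχ.approx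
    have hb : ∀ k, μ⁻[fun ω => ENNReal.ofReal (|martIncr Q γ X A f k ω| ^ ρ) | presentSigma X k]
        ≤ᵐ[μ] fun ω => ENNReal.ofReal (K * εGC (γ (k + 1)) * g (X k ω)) := fun k => by
      refine EventuallyLE.trans (EventuallyEq.le (condLExp_congr_ae ?_)) (happ k)
      filter_upwards [hχ0 k] with ω hω
      simp [hω]
    have hmart := hX.ae_tendsto_sum_martIncr_div hQ hγ hfm ham hfi hai hρ hεX hεGC hw hg hg0 hSW
      hK hb
    filter_upwards [hmart, hexp, hfb] with ω h1 h2 h3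
    have h4 := ((h3.add (hterm _ hηtop ω)).add h2).add (h1.mul hlim)
    simp only [zero_mul, zero_add, add_zero] at h4
    refine h4.congr' ?_
    filter_upwards [hXtop.eventually_gt_atTop 0] with n hn
    rw [midMean_eq (Q := Q) hγ X hC, div_mul_div_cancel₀ hn.ne']
    ring
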